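/- For a set $A$ of positive integers let $P_n(A)=\#(A\cap\{1,\dots,n\})/n$ be its density on $\{1,\dots,n\}$; let $p$ always denote a prime, $\pi(n)$ the number of primes up to $n$, and $\gamma$ Euler's constant. All asymptotics are for integers $n\to\infty$. (a) For every prime $p$ the multiples of $p$ have asymptotic density $\lim_{n\to\infty}P_n(\{m : p\mid m\})=1/p$. (b) There is a probability space with mutually independent events $D_p$ ($p$ prime) such that $\mathbb P(D_p)=1/p$ for all $p$. On every such space, for every integer $n\ge 0$, the sieve "probability" of primality, i.e. the probability that $D_p$ occurs for no prime $p\le\sqrt n$, equals $\prod_{p\le\sqrt n}(1-1/p)$. (c) This sieve probability satisfies $$\prod_{p\le\sqrt n}\Bigl(1-\frac1p\Bigr)=\frac{2e^{-\gamma}}{\ln n}\,(1+o(1)).$$ (d) The true density of the primes on $\{1,\dots,n\}$ is $\pi(n)/n$, and $$\frac{\pi(n)}{n}=\frac{1}{\ln n}\,(1+o(1)).$$ (e) Consequently the leading terms in (c) and (d) differ by the constant factor $2e^{-\gamma}$: $$\lim_{n\to\infty}\frac{\prod_{p\le\sqrt n}(1-1/p)}{\pi(n)/n}=2e^{-\gamma},\qquad\text{and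 } 2e^{-\gamma}\ne 1.$$ -/

import Mathlib

open Filter Topology Asymptotics MeasureTheory ProbabilityTheory

noncomputable section

/-- The density `#(A ∩ {1, …, n}) / n` of a set `A` of natural numbers on `{1, …, n}`, i.e. the
probability that a uniformly chosen element of `{1, …, n}` lies in `A`. -/
def segmentDensity (A : Set ℕ) (n : ℕ) : ℝ :=
  (A ∩ Set.Icc 1 n).ncard / n

/-- `A` has asymptotic density `d`. -/
def HasAsymptoticDensity (A : Set ℕ) (d : ℝ) : Prop :=
  Tendsto (segmentDensity A) atTop (𝓝 d)

/-- The sieve product `∏_{p ≤ √n} (1 - 1/p)` over primes `p`. -/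
def sieveProduct (n : ℕ) : ℝ :=
  ∏ p ∈ Finset.Icc 1 ⌊√(n : ℝ)⌋₊ with p.Prime, (1 - 1 / (p : ℝ))

/-- The heuristic sieve model: on a probability space, the events `D p` ("divisible by `p`"),
`p` prime, are mutually independent and `D p` has probability `1 / p`. -/
structure IsSieveModel {Ω : Type*} [MeasurableSpace Ω] (μ : Measure Ω)
    (D : Nat.Primes → Set Ω) : Prop where
  isProbabilityMeasure : IsProbabilityMeasure μ
  measurableSet : ∀ p, MeasurableSet (D p)
  indep : iIndepSet D μ
  prob : ∀ p : Nat.Primes, μ.real (D p) = 1 / ((p : ℕ) : ℝ)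

/-- The event that no prime `p ≤ √n` "divides": what the sieve of Eratosthenes leaves. -/
def siftedEvent {Ω : Type*} (D : Nat.Primes → Set Ω) (n : ℕ) : Set Ω :=
  {ω | ∀ p : Nat.Primes, ((p : ℕ) : ℝ) ≤ √(n : ℝ) → ω ∉ D p}

/-- `f n = g n * (1 + o(1))` as `n → ∞`, with the identity for every `n ≥ 2`. -/
def EqOneAddLittleO (f g : ℕ → ℝ) : Prop :=
  ∃ ε : ℕ → ℝ, ε =o[atTop] (fun _ => (1 : ℝ)) ∧ ∀ n : ℕ, 2 ≤ n → f n = g n * (1 + ε n)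

end

/-!
The sieve side and the counting side both multiply by `log n` to a limit, and the theorem is the
comparison of the two limits: `∏_{p ≤ √n} (1 - 1/p) · log n → 2 e^{-γ}` is Mertens' third theorem
at `√n` (the factor `2` being `log n / log √n`), and `π(n) / n · log n → 1` is the prime number
theorem.

**Prime number theorem.** Put `a t = ψ(exp t) exp (-t)`, which is bounded by Chebyshev's estimate.
The Laplace transform of `a - 1` is, up to an elementary term, `-ζ'/ζ (s) - 1/(s - 1)`, shifted by
one and divided by `s`; as `ζ` has no zeros on `re s = 1` it extends continuously to the closed half
plane (`integral_psi_exp_sub_one`). The Fejér kernel has its spectrum in `[-1, 1]`, so a Fejér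
average of `a - 1` around `x` is the integral of this transform over a compact segment of the
boundary line against `exp (i x y)` (`integral_mul_fejerKernel`), and it tends to zero as `x → ∞` by
the Riemann–Lebesgue lemma. This holds at every scale. As `ψ` is increasing, `a` cannot drop
quickly, and narrow averages tending to `1` force `a → 1` (`tendsto_one_of_tendsto_fejer_average`).
Mathlib's partial summation passes from `ψ` to `π`.

**Mertens' theorems.** Legendre's formula for `log n!` gives `∑_{p ≤ x} log p / p = log x + O(1)`,
and partial summation gives `∑_{p ≤ x} 1/p = log log x + M + o(1)` for some `M`. To find `M`, write
`∑_p p^{-(1 + δ)}` as the average of `∑_{p ≤ exp (v/δ)} 1/p` with respect to the density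
`exp (-v)`. As `δ → 0` this is `-log δ + M + ∫ log v · exp (-v) dv + o(1)`, and the last integral is
`Γ'(1) = -γ` (`tendsto_tsum_prime_rpow_add_log`). On the other hand the Euler product and
`log ζ(1 + δ) = -log δ + o(1)` give the same sum as `-log δ - H + o(1)`, where
`H = ∑_p (-log (1 - 1/p) - 1/p)`. Hence `M + H = γ`, which is the third theorem
(`tendsto_prod_one_sub_one_div_mul_log`).

The probability space is an infinite product of Bernoulli measures (`exists_isSieveModel`).
-/

/-! ### Density of multiples and of the primes -/

theorem ncard_dvd_inter_Icc (p n : ℕ) : ({m : ℕ | p ∣ m} ∩ Set.Icc 1 n).ncard = n / p := by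
  rw [← Nat.Ioc_filter_dvd_card_eq_div, ← Set.ncard_coe_finset]
  congr 1
  ext m
  simp [Nat.one_le_iff_ne_zero, Nat.pos_iff_ne_zero, and_comm]

theorem hasAsymptoticDensity_dvd (p : ℕ) : HasAsymptoticDensity {m : ℕ | p ∣ m} (1 / (p : ℝ)) := by
  have h : Tendsto (fun n : ℕ => (⌊(1 / (p : ℝ)) * (n : ℝ)⌋₊ : ℝ) / n) atTop (𝓝 (1 / (p : ℝ))) :=
    (tendsto_nat_floor_mul_div_atTop (by positivity)).comp tendsto_natCast_atTop_atTop
  refine h.congr fun n => ?_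
  rw [segmentDensity, ncard_dvd_inter_Icc, ← Nat.floor_div_eq_div (K := ℝ)]
  congr 3
  ring

theorem segmentDensity_prime (n : ℕ) :
    segmentDensity {m : ℕ | m.Prime} n = (Nat.primeCounting n : ℝ) / n := by
  rw [segmentDensity, ← Nat.primesLE_card_eq_primeCounting, ← Set.ncard_coe_finset]
  congr 3
  ext m
  simp only [Set.mem_inter_iff, Set.mem_ofPred_eq, Set.mem_Icc, Finset.mem_coe, Nat.mem_primesLE]
  exact ⟨fun h => ⟨h.2.2, h.1⟩, fun h => ⟨h.2, h.2.one_le, h.1⟩⟩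

/-! ### The sieve model -/

/-- Infinitely many independent biased coins, one for each prime, form a sieve model: the
coordinates of an infinite product of Bernoulli measures. -/
theorem exists_isSieveModel :
    ∃ (Ω : Type) (_ : MeasurableSpace Ω) (μ : Measure Ω) (D : Nat.Primes → Set Ω),
      IsSieveModel μ D := by
  let q (p : Nat.Primes) : unitInterval :=
    ⟨1 / ((p : ℕ) : ℝ), by positivity, div_le_one_of_le₀ (by exact_mod_cast p.2.one_le)
      (by positivity)⟩
  let ν (p : Nat.Primes) : Measure Bool := bernoulliMeasure true false (q p)
  refine ⟨Nat.Primes → Bool, inferInstance, Measure.infinitePi ν, fun p => {ω | ω p = true}, ?_⟩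
  have hν (p : Nat.Primes) : (ν p).real {true} = 1 / ((p : ℕ) : ℝ) := by
    classical
    rw [bernoulliMeasure_real_apply_of_mem_of_notMem _ (by simp) (by simp) (by simp)]
  have hD (p : Nat.Primes) : MeasurableSet {ω : Nat.Primes → Bool | ω p = true} :=
    measurableSet_eq_fun (measurable_pi_apply p) measurable_const
  have hprod (s : Finset Nat.Primes) :
      Measure.infinitePi ν (⋂ p ∈ s, {ω | ω p = true}) = ∏ p ∈ s, ν p {true} := by
    rw [← Measure.infinitePi_pi ν (s := s) (t := fun _ => {true}) (by simp)]
    congr 1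
    ext ω
    simp [Set.mem_pi]
  have hone (p : Nat.Primes) : Measure.infinitePi ν {ω | ω p = true} = ν p {true} := by
    simpa using hprod {p}
  refine ⟨inferInstance, hD, ?_, fun p => ?_⟩
  · rw [iIndepSet_iff_meas_biInter hD]
    intro s
    rw [hprod]
    exact Finset.prod_congr rfl fun p _ => (hone p).symm
  · rw [measureReal_def, hone, ← measureReal_def, hν]

theorem sieveProduct_eq_primesLE (n : ℕ) :
    sieveProduct n = ∏ p ∈ Nat.primesLE ⌊√(n : ℝ)⌋₊, (1 - 1 / (p : ℝ)) := by
  rw [sieveProduct]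
  congr 1
  ext p
  simp only [Finset.mem_filter, Finset.mem_Icc, Nat.mem_primesLE]
  exact ⟨fun h => ⟨h.1.2, h.2⟩, fun h => ⟨⟨h.2.one_le, h.1⟩, h.2⟩⟩

/-- The complement of `D p` lies in the σ-algebra generated by `D p`, so the complements are
independent as well. -/
theorem IsSieveModel.measureReal_siftedEvent {Ω : Type*} [MeasurableSpace Ω] {μ : Measure Ω}
    {D : Nat.Primes → Set Ω} (h : IsSieveModel μ D) (n : ℕ) :
    μ.real (siftedEvent D n) = sieveProduct n := by
  have := h.isProbabilityMeasure
  have hi := (iIndepSet_iff_iIndep _ _).1 h.indep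
  let s : Finset Nat.Primes := (Nat.primesLE ⌊√(n : ℝ)⌋₊).subtype Nat.Prime
  have hs (p : Nat.Primes) : p ∈ s ↔ ((p : ℕ) : ℝ) ≤ √(n : ℝ) := by
    refine Finset.mem_subtype.trans ?_
    rw [Nat.mem_primesLE, Nat.le_floor_iff (by positivity)]
    exact and_iff_left p.2
  have hset : siftedEvent D n = ⋂ p ∈ s, (D p)ᶜ := by
    ext ω
    simp [siftedEvent, hs]
  rw [hset, measureReal_def, hi.meas_biInter (fun p _ =>
    (MeasurableSpace.measurableSet_generateFrom (Set.mem_singleton _)).compl), ENNReal.toReal_prod,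
    sieveProduct_eq_primesLE]
  have hsub : (Nat.primesLE ⌊√(n : ℝ)⌋₊).filter Nat.Prime = Nat.primesLE ⌊√(n : ℝ)⌋₊ :=
    Finset.filter_true_of_mem fun p hp => (Nat.mem_primesLE.1 hp).2
  rw [← hsub, ← Finset.subtype_map, Finset.prod_map]
  refine Finset.prod_congr rfl fun p _ => ?_
  rw [← measureReal_def, probReal_compl_eq_one_sub (h.measurableSet p), h.prob p]
  rfl

/-! ### Equality up to a factor `1 + o(1)` -/

theorem eqOneAddLittleO_of_tendsto_div {f g : ℕ → ℝ} (hg : ∀ n, 2 ≤ n → g n ≠ 0)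
    (h : Tendsto (fun n => f n / g n) atTop (𝓝 1)) : EqOneAddLittleO f g := by
  refine ⟨fun n => f n / g n - 1, ?_, fun n hn => ?_⟩
  · rw [isLittleO_one_iff]
    simpa using h.sub_const 1
  · field_simp [hg n hn]
    ring

/-- Since `γ < 2 / 3 < log 2`, the constant `2 * exp (-γ)` exceeds `1`. -/
theorem two_mul_exp_neg_eulerMascheroniConstant_ne_one :
    2 * Real.exp (-Real.eulerMascheroniConstant) ≠ 1 := by
  have h1 := Real.eulerMascheroniConstant_lt_two_thirds
  have h2 := Real.log_two_gt_d9
  have h3 : Real.exp (-Real.log 2) < Real.exp (-Real.eulerMascheroniConstant) :=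
    Real.exp_lt_exp.2 (by linarith)
  rw [Real.exp_neg, Real.exp_log two_pos] at h3
  linarith

/-! ### The Fejér kernel -/

/-- The (unnormalized) Fejér kernel `v ↦ (1 - cos v) / v ^ 2` on the real line, defined as the
cosine transform of the triangle function, so that its spectrum visibly lies in `[-1, 1]`. -/
noncomputable def fejerKernel (v : ℝ) : ℝ :=
  ∫ y in (0 : ℝ)..1, (1 - y) * Real.cos (y * v)

theorem continuous_fejerKernel : Continuous fejerKernel := by
  unfold fejerKernel
  exact intervalIntegral.continuous_parametric_intervalIntegral_of_continuous' (by fun_prop) 0 1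

theorem fejerKernel_zero : fejerKernel 0 = 1 / 2 := by
  have h := intervalIntegral.integral_comp_sub_left (a := 0) (b := 1) (fun u : ℝ => u) 1
  simp only [fejerKernel, mul_zero, Real.cos_zero, mul_one, h]
  norm_num

theorem fejerKernel_of_ne_zero {v : ℝ} (hv : v ≠ 0) :
    fejerKernel v = (1 - Real.cos v) / v ^ 2 := by
  have hderiv (y : ℝ) : HasDerivAt
      (fun y => (1 - y) * (Real.sin (y * v) / v) - Real.cos (y * v) / v ^ 2)
      ((1 - y) * Real.cos (y * v)) y := by
    have h1 : HasDerivAt (fun y : ℝ => y * v) v y := by simpa using (hasDerivAt_id y).mul_const v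
    have h2 := ((hasDerivAt_id y).const_sub 1).mul (h1.sin.div_const v)
    have h3 := h1.cos.div_const (v ^ 2)
    refine (h2.sub h3).congr_deriv ?_
    rw [id_eq]
    field_simp
    ring
  rw [fejerKernel, intervalIntegral.integral_eq_sub_of_hasDerivAt (fun y _ => hderiv y)
    (Continuous.intervalIntegrable (by fun_prop) _ _)]
  simp
  ring

theorem fejerKernel_nonneg (v : ℝ) : 0 ≤ fejerKernel v := by
  rcases eq_or_ne v 0 with rfl | hv
  · rw [fejerKernel_zero]
    norm_num
  · rw [fejerKernel_of_ne_zero hv]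
    exact div_nonneg (by linarith [Real.cos_le_one v]) (by positivity)

theorem fejerKernel_le (v : ℝ) : fejerKernel v ≤ 4 * (1 + v ^ 2)⁻¹ := by
  rw [← div_eq_mul_inv]
  rcases eq_or_ne v 0 with rfl | hv
  · rw [fejerKernel_zero]
    norm_num
  · rw [fejerKernel_of_ne_zero hv, div_le_div_iff₀ (by positivity) (by positivity)]
    nlinarith [Real.neg_one_le_cos v, Real.one_sub_sq_div_two_le_cos (x := v), sq_nonneg v,
      mul_nonneg (sq_nonneg v) (by linarith [Real.neg_one_le_cos v] : 0 ≤ Real.cos v + 1)]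

theorem integrable_fejerKernel : Integrable fejerKernel := by
  refine (integrable_inv_one_add_sq.const_mul 4).mono'
    continuous_fejerKernel.aestronglyMeasurable (ae_of_all _ fun v => ?_)
  rw [Real.norm_of_nonneg (fejerKernel_nonneg v)]
  exact fejerKernel_le v

theorem integral_fejerKernel_pos : 0 < ∫ v, fejerKernel v := by
  rw [integral_pos_iff_support_of_nonneg fejerKernel_nonneg integrable_fejerKernel]
  exact continuous_fejerKernel.isOpen_support.measure_pos _ ⟨0, by simp [fejerKernel_zero]⟩

theorem integrable_fejerKernel_comp {l : ℝ} (hl : l ≠ 0) (x : ℝ) :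
    Integrable fun t => fejerKernel (l * (x - t)) :=
  (integrable_fejerKernel.comp_mul_left' hl).comp_sub_left x

/-! ### A Tauberian theorem of Wiener–Ikehara type -/

section Tauberian

variable {c : ℝ → ℝ} {M : ℝ} {G : ℂ → ℂ}

theorem integrableOn_mul_exp_neg (hc : Measurable c) (hM : ∀ t, |c t| ≤ M) {ε : ℝ} (hε : 0 < ε) :
    IntegrableOn (fun t => c t * Real.exp (-ε * t)) (Set.Ioi 0) :=
  ((exp_neg_integrableOn_Ioi 0 hε).bdd_mul (c := M) hc.aestronglyMeasurable
    (ae_of_all _ fun t => by simpa using hM t))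

/-- A modulated and damped average of `c` is read off from its Laplace transform on a vertical
line. -/
theorem integral_mul_exp_mul_cos_eq_re (hc : Measurable c) (hM : ∀ t, |c t| ≤ M)
    (hL : ∀ s : ℂ, 0 < s.re → ∫ t in Set.Ioi (0 : ℝ), (c t : ℂ) * Complex.exp (-s * t) = G s)
    {ε : ℝ} (hε : 0 < ε) (u x : ℝ) :
    ∫ t in Set.Ioi (0 : ℝ), c t * Real.exp (-ε * t) * Real.cos (u * (x - t)) =
      (Complex.exp (u * x * Complex.I) * G (ε + u * Complex.I)).re := by
  have hre : 0 < ((ε : ℂ) + u * Complex.I).re := by simpa using hε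
  rw [← hL _ hre, ← integral_const_mul]
  have hint : IntegrableOn (fun t : ℝ => Complex.exp (u * x * Complex.I) *
      ((c t : ℂ) * Complex.exp (-(ε + u * Complex.I) * t))) (Set.Ioi 0) := by
    refine Integrable.const_mul ?_ _
    refine Integrable.mono (integrableOn_mul_exp_neg hc hM hε)
      (Measurable.aestronglyMeasurable (by fun_prop)) (ae_of_all _ fun t => ?_)
    simp [Complex.norm_exp]
  rw [← RCLike.re_eq_complex_re, ← integral_re hint]
  refine integral_congr_ae (ae_of_all _ fun t => ?_)
  simp only [RCLike.re_eq_complex_re]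
  rw [mul_left_comm, ← Complex.exp_add, Complex.re_ofReal_mul, mul_assoc, Complex.exp_re]
  congr 3 <;> simp
  ring_nf

/-- Fubini's theorem turns a damped Fejér average of `c` into an integral of its Laplace transform
over a segment of the line `re s = ε`. -/
theorem integral_mul_exp_mul_fejerKernel (hc : Measurable c) (hM : ∀ t, |c t| ≤ M)
    (hL : ∀ s : ℂ, 0 < s.re → ∫ t in Set.Ioi (0 : ℝ), (c t : ℂ) * Complex.exp (-s * t) = G s)
    {ε : ℝ} (hε : 0 < ε) (l x : ℝ) :
    ∫ t in Set.Ioi (0 : ℝ), c t * Real.exp (-ε * t) * fejerKernel (l * (x - t)) =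
      ∫ y in Set.Ioc (0 : ℝ) 1,
        (1 - y) * (Complex.exp ((y * l : ℝ) * x * Complex.I) *
          G (ε + (y * l : ℝ) * Complex.I)).re := by
  have hint : Integrable (Function.uncurry fun t y : ℝ =>
      c t * Real.exp (-ε * t) * ((1 - y) * Real.cos (y * (l * (x - t)))))
      ((volume.restrict (Set.Ioi 0)).prod (volume.restrict (Set.Ioc 0 1))) := by
    have h1 : IntegrableOn (fun _ : ℝ => (1 : ℝ)) (Set.Ioc 0 1) := by simp
    refine (Integrable.mul_prod (integrableOn_mul_exp_neg hc hM hε) h1).mono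
      (Measurable.aestronglyMeasurable (by fun_prop)) ?_
    have hmem : ∀ᵐ z ∂((volume.restrict (Set.Ioi (0 : ℝ))).prod
        (volume.restrict (Set.Ioc (0 : ℝ) 1))), z ∈ Set.Ioi (0 : ℝ) ×ˢ Set.Ioc (0 : ℝ) 1 := by
      rw [Measure.prod_restrict]
      exact ae_restrict_mem (measurableSet_Ioi.prod measurableSet_Ioc)
    filter_upwards [hmem] with z hz
    rw [Function.uncurry, norm_mul, norm_mul _ (1 : ℝ)]
    refine mul_le_mul_of_nonneg_left ?_ (norm_nonneg _)
    rw [norm_mul, norm_one, Real.norm_eq_abs, Real.norm_eq_abs]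
    exact mul_le_one₀ (abs_le.2 ⟨by linarith [hz.2.2], by linarith [hz.2.1]⟩) (abs_nonneg _)
      (Real.abs_cos_le_one _)
  have hswap := integral_integral_swap hint
  calc _ = ∫ t in Set.Ioi (0 : ℝ), ∫ y in Set.Ioc (0 : ℝ) 1,
        c t * Real.exp (-ε * t) * ((1 - y) * Real.cos (y * (l * (x - t)))) := by
        refine integral_congr_ae (ae_of_all _ fun t => ?_)
        simp only
        rw [integral_const_mul, fejerKernel, intervalIntegral.integral_of_le zero_le_one]
    _ = _ := hswap
    _ = _ := by
        refine integral_congr_ae (ae_of_all _ fun y => ?_)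
        simp only
        rw [← integral_mul_exp_mul_cos_eq_re hc hM hL hε, ← integral_const_mul]
        refine integral_congr_ae (ae_of_all _ fun t => ?_)
        simp only
        rw [mul_assoc y l]
        ring

/-- Letting the damping tend to zero in `integral_mul_exp_mul_fejerKernel`: only the continuity of
the Laplace transform up to the boundary line is needed. -/
theorem integral_mul_fejerKernel (hc : Measurable c) (hM : ∀ t, |c t| ≤ M)
    (hG : ContinuousOn G {s | 0 ≤ s.re})
    (hL : ∀ s : ℂ, 0 < s.re → ∫ t in Set.Ioi (0 : ℝ), (c t : ℂ) * Complex.exp (-s * t) = G s)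
    {l : ℝ} (hl : 0 < l) (x : ℝ) :
    ∫ t in Set.Ioi (0 : ℝ), c t * fejerKernel (l * (x - t)) =
      ∫ y in Set.Ioc (0 : ℝ) 1,
        (1 - y) * (Complex.exp ((y * l : ℝ) * x * Complex.I) *
          G ((y * l : ℝ) * Complex.I)).re := by
  have hleft : Tendsto (fun ε : ℝ =>
      ∫ t in Set.Ioi (0 : ℝ), c t * Real.exp (-ε * t) * fejerKernel (l * (x - t))) (𝓝[>] 0)
      (𝓝 (∫ t in Set.Ioi (0 : ℝ), c t * fejerKernel (l * (x - t)))) := by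
    have hK := continuous_fejerKernel.measurable
    refine tendsto_integral_filter_of_dominated_convergence
      (fun t => M * fejerKernel (l * (x - t)))
      (Eventually.of_forall fun ε => Measurable.aestronglyMeasurable (by fun_prop)) ?_
      ((integrable_fejerKernel_comp hl.ne' x).const_mul M).integrableOn
      (ae_of_all _ fun t => ?_)
    · filter_upwards [self_mem_nhdsWithin] with ε (hε : 0 < ε)
      filter_upwards [ae_restrict_mem measurableSet_Ioi] with t (ht : 0 < t)
      rw [norm_mul, norm_mul, Real.norm_of_nonneg (fejerKernel_nonneg _), Real.norm_eq_abs,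
        Real.norm_of_nonneg (Real.exp_pos _).le]
      refine mul_le_mul_of_nonneg_right ?_ (fejerKernel_nonneg _)
      calc |c t| * Real.exp (-ε * t) ≤ M * 1 :=
            mul_le_mul (hM t) (Real.exp_le_one_iff.2 (by nlinarith)) (Real.exp_pos _).le
              ((abs_nonneg _).trans (hM t))
        _ = M := mul_one M
    · have : Tendsto (fun ε : ℝ => c t * Real.exp (-ε * t) * fejerKernel (l * (x - t))) (𝓝 0)
          (𝓝 (c t * Real.exp (-0 * t) * fejerKernel (l * (x - t)))) :=
        Continuous.tendsto (by fun_prop) 0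
      simpa using this.mono_left nhdsWithin_le_nhds
  have hright : Tendsto (fun ε : ℝ => ∫ y in Set.Ioc (0 : ℝ) 1,
        (1 - y) * (Complex.exp ((y * l : ℝ) * x * Complex.I) *
          G (ε + (y * l : ℝ) * Complex.I)).re) (𝓝[>] 0)
      (𝓝 (∫ y in Set.Ioc (0 : ℝ) 1, (1 - y) * (Complex.exp ((y * l : ℝ) * x * Complex.I) *
          G ((y * l : ℝ) * Complex.I)).re)) := by
    obtain ⟨B, hB⟩ : ∃ B, ∀ z ∈ Set.Icc (0 : ℝ) 1 ×ˢ Set.Icc (0 : ℝ) l,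
        ‖G ((z.1 : ℂ) + z.2 * Complex.I)‖ ≤ B := by
      refine (isCompact_Icc.prod isCompact_Icc).exists_bound_of_continuousOn
        (f := fun z : ℝ × ℝ => G ((z.1 : ℂ) + z.2 * Complex.I)) ?_
      refine hG.comp (Continuous.continuousOn (by fun_prop)) fun z hz => ?_
      simpa using hz.1.1
    have hGy (ε : ℝ) (hε : 0 ≤ ε) :
        Continuous fun y : ℝ => G (ε + (y * l : ℝ) * Complex.I) :=
      hG.comp_continuous (by fun_prop) fun y => by simpa using hε
    refine tendsto_integral_filter_of_dominated_convergence (fun _ => B) ?_ ?_ (by simp) ?_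
    · filter_upwards [self_mem_nhdsWithin] with ε (hε : 0 < ε)
      have hexp : Continuous fun y : ℝ => Complex.exp ((y * l : ℝ) * x * Complex.I) := by fun_prop
      exact ((continuous_const.sub continuous_id).mul
        (Complex.continuous_re.comp (hexp.mul (hGy ε hε.le)))).aestronglyMeasurable
    · have h1 : ∀ᶠ ε : ℝ in 𝓝[>] 0, ε ≤ 1 :=
        nhdsWithin_le_nhds (eventually_le_nhds zero_lt_one)
      filter_upwards [self_mem_nhdsWithin, h1] with ε (hε : 0 < ε) hε1
      filter_upwards [ae_restrict_mem measurableSet_Ioc] with y hy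
      have hb := hB (ε, y * l) ⟨⟨hε.le, hε1⟩, ⟨by have := hy.1; positivity, by nlinarith [hy.2]⟩⟩
      have hre : |(Complex.exp ((y * l : ℝ) * x * Complex.I) *
          G (ε + (y * l : ℝ) * Complex.I)).re| ≤ B := by
        refine (Complex.abs_re_le_norm _).trans ?_
        rw [norm_mul, ← Complex.ofReal_mul, Complex.norm_exp_ofReal_mul_I, one_mul]
        exact hb
      rw [norm_mul, Real.norm_eq_abs, Real.norm_eq_abs]
      calc |1 - y| * _ ≤ 1 * B :=
            mul_le_mul (abs_le.2 ⟨by linarith [hy.2], by linarith [hy.1]⟩) hre (abs_nonneg _)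
              zero_le_one
        _ = B := one_mul B
    · refine ae_of_all _ fun y => ?_
      have hcont : Tendsto (fun ε : ℝ => G (ε + (y * l : ℝ) * Complex.I)) (𝓝[>] 0)
          (𝓝 (G ((y * l : ℝ) * Complex.I))) := by
        have h0 : ContinuousWithinAt G {s | 0 ≤ s.re} ((y * l : ℝ) * Complex.I) :=
          hG _ (by simp)
        refine h0.tendsto.comp (tendsto_nhdsWithin_iff.2 ⟨?_, ?_⟩)
        · have : Tendsto (fun ε : ℝ => (ε : ℂ) + (y * l : ℝ) * Complex.I) (𝓝 0)
              (𝓝 (((0 : ℝ) : ℂ) + (y * l : ℝ) * Complex.I)) :=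
            Continuous.tendsto (by fun_prop) 0
          simpa using this.mono_left nhdsWithin_le_nhds
        · filter_upwards [self_mem_nhdsWithin] with ε (hε : 0 < ε)
          simpa using hε.le
      exact ((Complex.continuous_re.tendsto _).comp (hcont.const_mul _)).const_mul _
  refine tendsto_nhds_unique (hleft.congr' ?_) hright
  filter_upwards [self_mem_nhdsWithin] with ε hε
  exact integral_mul_exp_mul_fejerKernel hc hM hL hε l x

/-- The Fejér averages of `c` tend to zero, by the Riemann–Lebesgue lemma applied to the boundary
values of its Laplace transform. -/
theorem tendsto_integral_mul_fejerKernel (hc : Measurable c) (hM : ∀ t, |c t| ≤ M)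
    (hG : ContinuousOn G {s | 0 ≤ s.re})
    (hL : ∀ s : ℂ, 0 < s.re → ∫ t in Set.Ioi (0 : ℝ), (c t : ℂ) * Complex.exp (-s * t) = G s)
    {l : ℝ} (hl : 0 < l) :
    Tendsto (fun x : ℝ => ∫ t in Set.Ioi (0 : ℝ), c t * fejerKernel (l * (x - t))) atTop
      (𝓝 0) := by
  let f : ℝ → ℂ := (Set.Ioc (0 : ℝ) 1).indicator fun y => (1 - y) * G ((y * l : ℝ) * Complex.I)
  have hcont : Continuous fun y : ℝ => G ((y * l : ℝ) * Complex.I) :=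
    hG.comp_continuous (by fun_prop) fun y => by simp
  have hw : Tendsto (fun x : ℝ => -(l * x / (2 * Real.pi))) atTop (cocompact ℝ) := by
    refine Tendsto.mono_right ?_ atBot_le_cocompact
    refine tendsto_neg_atTop_atBot.comp ?_
    exact (tendsto_id.const_mul_atTop hl).atTop_div_const (by positivity)
  have hRL := (Complex.continuous_re.tendsto 0).comp
    ((Real.tendsto_integral_exp_smul_cocompact f).comp hw)
  rw [Complex.zero_re] at hRL
  refine hRL.congr fun x => ?_
  rw [integral_mul_fejerKernel hc hM hG hL hl]
  have hf (v : ℝ) : Real.fourierChar (-(v * -(l * x / (2 * Real.pi)))) • f v =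
      (Set.Ioc (0 : ℝ) 1).indicator (fun y : ℝ => (1 - y : ℝ) *
        (Complex.exp ((y * l : ℝ) * x * Complex.I) * G ((y * l : ℝ) * Complex.I))) v := by
    by_cases hv : v ∈ Set.Ioc (0 : ℝ) 1
    · simp only [f, Set.indicator_of_mem hv, Circle.smul_def, Real.fourierChar_apply, smul_eq_mul]
      have : ((2 * Real.pi * -(v * -(l * x / (2 * Real.pi))) : ℝ) : ℂ) = (v * l : ℝ) * x := by
        rw [← Complex.ofReal_mul]
        congr 1
        field_simp
      rw [this]
      push_cast
      ring
    · simp [f, Set.indicator_of_notMem hv]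
  simp only [Function.comp_apply, hf]
  rw [integral_indicator measurableSet_Ioc]
  have hint : IntegrableOn (fun y : ℝ => ((1 - y : ℝ) : ℂ) *
      (Complex.exp ((y * l : ℝ) * x * Complex.I) * G ((y * l : ℝ) * Complex.I)))
      (Set.Ioc 0 1) := by
    have hexp : Continuous fun y : ℝ => Complex.exp ((y * l : ℝ) * x * Complex.I) := by fun_prop
    exact ((Complex.continuous_ofReal.comp (continuous_const.sub continuous_id)).mul
      (hexp.mul hcont)).integrableOn_Icc.mono_set Set.Ioc_subset_Icc_self
  rw [← RCLike.re_eq_complex_re, ← integral_re hint]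
  refine integral_congr_ae (ae_of_all _ fun y => ?_)
  simp only [RCLike.re_eq_complex_re, Complex.re_ofReal_mul]

end Tauberian

theorem integral_mul_fejerKernel_eq_smul (b : ℝ → ℝ) {l : ℝ} (hl : 0 < l) (x : ℝ) :
    ∫ t, b t * fejerKernel (l * (x - t)) = l⁻¹ * ∫ v, b (x - v / l) * fejerKernel v := by
  have h1 := integral_sub_left_eq_self (fun u => b (x - u) * fejerKernel (l * u)) volume x
  have h2 := Measure.integral_comp_mul_left (fun v => b (x - v / l) * fejerKernel v) l
  simp only [sub_sub_cancel] at h1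
  rw [h1, abs_of_pos (inv_pos.2 hl), smul_eq_mul] at *
  rw [← h2]
  refine integral_congr_ae (ae_of_all _ fun u => ?_)
  simp only
  rw [mul_div_cancel_left₀ _ hl.ne']

/-- If a function bounded below by `-M` is at least `q` on the window `[-V, V]`, then its average
against the Fejér kernel is at least `q` times the mass of the kernel on the window, up to `M` times
the mass outside. -/
theorem le_integral_mul_fejerKernel {b : ℝ → ℝ} (hb : Measurable b) {M : ℝ}
    (hM : ∀ t, |b t| ≤ M) {V q : ℝ} (hq : ∀ v ∈ Set.Icc (-V) V, q ≤ b v) :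
    q * (∫ v in Set.Icc (-V) V, fejerKernel v) -
      M * ((∫ v, fejerKernel v) - ∫ v in Set.Icc (-V) V, fejerKernel v) ≤
      ∫ v, b v * fejerKernel v := by
  have hK := integrable_fejerKernel
  have hint : Integrable fun v => b v * fejerKernel v :=
    hK.bdd_mul (c := M) hb.aestronglyMeasurable (ae_of_all _ fun t => by simpa using hM t)
  have hcompl := integral_add_compl (s := Set.Icc (-V) V) measurableSet_Icc hK
  rw [← integral_add_compl (s := Set.Icc (-V) V) measurableSet_Icc hint, ← hcompl]
  have h1 : q * (∫ v in Set.Icc (-V) V, fejerKernel v) ≤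
      ∫ v in Set.Icc (-V) V, b v * fejerKernel v := by
    rw [← integral_const_mul]
    exact setIntegral_mono_on (hK.const_mul q).integrableOn hint.integrableOn measurableSet_Icc
      fun v hv => mul_le_mul_of_nonneg_right (hq v hv) (fejerKernel_nonneg v)
  have h2 : -M * (∫ v in (Set.Icc (-V) V)ᶜ, fejerKernel v) ≤
      ∫ v in (Set.Icc (-V) V)ᶜ, b v * fejerKernel v := by
    rw [← integral_const_mul]
    exact setIntegral_mono_on (hK.const_mul (-M)).integrableOn hint.integrableOn
      measurableSet_Icc.compl
      fun v _ => mul_le_mul_of_nonneg_right (abs_le.1 (hM v)).1 (fejerKernel_nonneg v)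
  linarith

/-- For large windows the mass of the Fejér kernel outside the window is negligible. -/
theorem exists_window_fejerKernel (M : ℝ) {ε : ℝ} (hε : 0 < ε) :
    ∃ V > 0, 0 < (∫ v in Set.Icc (-V) V, fejerKernel v) ∧
      M * ((∫ v, fejerKernel v) - ∫ v in Set.Icc (-V) V, fejerKernel v) <
        ε * ∫ v in Set.Icc (-V) V, fejerKernel v := by
  have hlim : Tendsto (fun V : ℝ => ∫ v in Set.Icc (-V) V, fejerKernel v) atTop
      (𝓝 (∫ v, fejerKernel v)) :=
    (aecover_Icc tendsto_neg_atTop_atBot tendsto_id).integral_tendsto_of_countably_generated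
      integrable_fejerKernel
  have hI := integral_fejerKernel_pos
  have h1 := hlim.eventually_const_lt hI
  have h2 := ((hlim.const_sub (∫ v, fejerKernel v)).const_mul M).eventually_lt
    (hlim.const_mul ε) (by rw [sub_self, mul_zero]; positivity)
  obtain ⟨V, ⟨hV1, hV2⟩, hV⟩ := ((h1.and h2).and (eventually_gt_atTop 0)).exists
  exact ⟨V, hV, hV1, hV2⟩

/-- A bounded function `a` that is slowly decreasing, in the sense that `a t * exp t` is monotone,
converges to `1` as soon as its Fejér averages at every scale do. -/
theorem tendsto_one_of_tendsto_fejer_average {a : ℝ → ℝ} (ha : Measurable a) {M : ℝ}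
    (hM : ∀ t, |a t - 1| ≤ M) (ha0 : ∀ t, 0 ≤ a t)
    (hmono : Monotone fun t => a t * Real.exp t)
    (hlim : ∀ l : ℝ, 0 < l → Tendsto
      (fun x : ℝ => ∫ t in Set.Ioi (0 : ℝ), (a t - 1) * fejerKernel (l * (x - t))) atTop (𝓝 0)) :
    Tendsto a atTop (𝓝 1) := by
  let b : ℝ → ℝ := (Set.Ioi (0 : ℝ)).indicator fun t => a t - 1
  have hb : Measurable b := (ha.sub_const 1).indicator measurableSet_Ioi
  have hM0 : 0 ≤ M := (abs_nonneg _).trans (hM 0)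
  have hbM (t : ℝ) : |b t| ≤ M := by
    by_cases ht : t ∈ Set.Ioi (0 : ℝ)
    · simpa [b, Set.indicator_of_mem ht] using hM t
    · simpa [b, Set.indicator_of_notMem ht] using hM0
  have hJ (l : ℝ) (hl : 0 < l) :
      Tendsto (fun x : ℝ => ∫ v, b (x - v / l) * fejerKernel v) atTop (𝓝 0) := by
    have h := (hlim l hl).const_mul l
    rw [mul_zero] at h
    refine h.congr fun x => ?_
    have hind : ∫ t in Set.Ioi (0 : ℝ), (a t - 1) * fejerKernel (l * (x - t)) =
        ∫ t, b t * fejerKernel (l * (x - t)) := by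
      rw [← integral_indicator measurableSet_Ioi]
      refine integral_congr_ae (ae_of_all _ fun t => ?_)
      simp only [b]
      rw [Set.indicator_mul_left]
    rw [hind, integral_mul_fejerKernel_eq_smul b hl, mul_inv_cancel_left₀ hl.ne']
  -- Over an interval of length `2 * h` the function `a` changes by at most the factor
  -- `exp (2 * h)`, so `a x` can be compared with an average over a window ending or starting at `x`.
  have key (h ε : ℝ) (hh : 0 < h) (hε : 0 < ε) :
      ∀ᶠ x in atTop, a x * Real.exp (-(2 * h)) - 1 < 2 * ε ∧
        -(2 * ε) < a x * Real.exp (2 * h) - 1 := by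
    obtain ⟨V, hV, hm, hVM⟩ := exists_window_fejerKernel M hε
    set m := ∫ v in Set.Icc (-V) V, fejerKernel v
    have hl : 0 < V / h := div_pos hV hh
    have hmeas (x : ℝ) : Measurable fun v => b (x - v / (V / h)) := hb.comp (by fun_prop)
    have hwin (v : ℝ) (hv : v ∈ Set.Icc (-V) V) : |v / (V / h)| ≤ h := by
      rw [abs_div, abs_of_pos hl, div_le_iff₀ hl, mul_div_cancel₀ _ hh.ne']
      exact abs_le.2 hv
    have hstep {s t : ℝ} (hst : s ≤ t) (hts : t ≤ s + 2 * h) :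
        a s * Real.exp (-(2 * h)) ≤ a t := by
      have h1 : a s * Real.exp s ≤ a t * Real.exp t := hmono hst
      have h2 : a s * Real.exp (-(2 * h)) ≤ a s * Real.exp (s - t) :=
        mul_le_mul_of_nonneg_left (Real.exp_le_exp.2 (by linarith)) (ha0 s)
      rw [Real.exp_sub, ← mul_div_assoc] at h2
      exact h2.trans ((div_le_iff₀ (Real.exp_pos t)).2 h1)
    have hJ' := (hJ _ hl).eventually (Metric.ball_mem_nhds 0 (mul_pos hε hm))
    filter_upwards [(tendsto_atTop_add_const_right _ h tendsto_id).eventually hJ',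
      (tendsto_atTop_add_const_right _ (-h) tendsto_id).eventually hJ',
      eventually_gt_atTop (2 * h)] with x hx1 hx2 hx3
    simp only [id, dist_zero_right, Real.norm_eq_abs] at hx1 hx2
    constructor
    · have hlow := le_integral_mul_fejerKernel (hmeas (x + h)) (fun t => hbM _) (V := V)
        (q := a x * Real.exp (-(2 * h)) - 1) fun v hv => by
          have := abs_le.1 (hwin v hv)
          have hpos : x + h - v / (V / h) ∈ Set.Ioi (0 : ℝ) := by
            simp only [Set.mem_Ioi]
            linarith
          simp only [b, Set.indicator_of_mem hpos]
          linarith [hstep (s := x) (t := x + h - v / (V / h)) (by linarith) (by linarith)]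
      have hup := (abs_lt.1 hx1).2
      nlinarith
    · have hlow := le_integral_mul_fejerKernel (b := fun v => -b (x + -h - v / (V / h)))
        (hmeas (x + -h)).neg (fun t => by rw [abs_neg]; exact hbM _) (V := V)
        (q := 1 - a x * Real.exp (2 * h)) fun v hv => by
          have := abs_le.1 (hwin v hv)
          have hpos : x + -h - v / (V / h) ∈ Set.Ioi (0 : ℝ) := by
            simp only [Set.mem_Ioi]
            linarith
          simp only [b, Set.indicator_of_mem hpos]
          have h1 := hstep (s := x + -h - v / (V / h)) (t := x) (by linarith) (by linarith)
          rw [Real.exp_neg, ← div_eq_mul_inv, div_le_iff₀ (Real.exp_pos _)] at h1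
          linarith
      simp only [neg_mul, integral_neg] at hlow
      have hup := (abs_lt.1 hx2).1
      nlinarith
  rw [Metric.tendsto_nhds]
  intro η hη
  have hup : ∀ᶠ ε : ℝ in 𝓝[>] 0, (1 + 2 * ε) * Real.exp (2 * ε) < 1 + η := by
    refine nhdsWithin_le_nhds (Tendsto.eventually_lt_const (u := 1 + η) (v := 1) (by linarith) ?_)
    exact Continuous.tendsto' (by fun_prop) _ _ (by simp)
  have hlow : ∀ᶠ ε : ℝ in 𝓝[>] 0, 1 - η < (1 - 2 * ε) * Real.exp (-(2 * ε)) := by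
    refine nhdsWithin_le_nhds (Tendsto.eventually_const_lt (u := 1 - η) (v := 1) (by linarith) ?_)
    exact Continuous.tendsto' (by fun_prop) _ _ (by simp)
  obtain ⟨ε, ⟨h1, h2⟩, hε⟩ := ((hup.and hlow).and self_mem_nhdsWithin).exists
  have hε : 0 < ε := hε
  filter_upwards [key ε ε hε hε] with x ⟨hx1, hx2⟩
  have hE := Real.exp_pos (2 * ε)
  rw [Real.exp_neg] at hx1 h2
  rw [Real.dist_eq, abs_lt]
  rw [← div_eq_mul_inv] at hx1 h2
  have hx1' : a x / Real.exp (2 * ε) < 1 + 2 * ε := by linarith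
  rw [div_lt_iff₀ hE] at hx1'
  have hx2' : (1 - 2 * ε) / Real.exp (2 * ε) < a x := by
    rw [div_lt_iff₀ hE]
    linarith
  constructor <;> linarith

/-! ### The prime number theorem -/

theorem riemannZeta₁_ne_zero_of_one_le_re {s : ℂ} (hs : 1 ≤ s.re) : riemannZeta₁ s ≠ 0 := by
  rcases eq_or_ne s 1 with rfl | h
  · simp
  · intro h0
    exact riemannZeta_ne_zero_of_one_le_re hs (by rw [riemannZeta_eq_inv_sub_mul h, h0, mul_zero])

/-- The continuous extension to `1 ≤ re s` of `-ζ'/ζ - 1 / (s - 1)`. -/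
noncomputable def negLogDerivZetaRegular (s : ℂ) : ℂ :=
  -(deriv riemannZeta₁ s / riemannZeta₁ s)

theorem continuousOn_negLogDerivZetaRegular :
    ContinuousOn negLogDerivZetaRegular {s | 1 ≤ s.re} :=
  (differentiable_riemannZeta₁.deriv.continuous.continuousOn.div
    differentiable_riemannZeta₁.continuous.continuousOn
    fun _ hs => riemannZeta₁_ne_zero_of_one_le_re hs).neg

theorem LSeries_vonMangoldt_eq_inv_sub_add {s : ℂ} (hs : 1 < s.re) :
    LSeries (fun n => (ArithmeticFunction.vonMangoldt n : ℂ)) s =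
      (s - 1)⁻¹ + negLogDerivZetaRegular s := by
  have h1 : s ≠ 1 := by
    rintro rfl
    simp at hs
  have h0 := riemannZeta₁_ne_zero_of_one_le_re hs.le
  have hs1 : s - 1 ≠ 0 := sub_ne_zero.2 h1
  rw [ArithmeticFunction.LSeries_vonMangoldt_eq_deriv_riemannZeta_div hs,
    deriv_riemannZeta_eq_neg_inv_sub_sq_mul_add h1, riemannZeta_eq_inv_sub_mul h1,
    negLogDerivZetaRegular]
  field_simp
  ring

theorem integral_Ioi_one_eq_integral_exp_smul {E : Type*} [NormedAddCommGroup E]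
    [NormedSpace ℝ E] (g : ℝ → E) :
    ∫ x in Set.Ioi (1 : ℝ), g x = ∫ t in Set.Ioi (0 : ℝ), Real.exp t • g (Real.exp t) := by
  have h := integral_image_eq_integral_abs_deriv_smul (s := Set.Ioi (0 : ℝ)) measurableSet_Ioi
    (fun x _ => (Real.hasDerivAt_exp x).hasDerivWithinAt) Real.exp_injective.injOn g
  rw [Real.image_exp_Ioi, Real.exp_zero] at h
  rw [h]
  exact integral_congr_ae (ae_of_all _ fun t => by simp only [abs_of_pos (Real.exp_pos t)])

theorem psi_exp_mul_exp_neg_mem (t : ℝ) :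
    0 ≤ Chebyshev.psi (Real.exp t) * Real.exp (-t) ∧
      Chebyshev.psi (Real.exp t) * Real.exp (-t) ≤ Real.log 4 + 4 := by
  refine ⟨mul_nonneg (Chebyshev.psi_nonneg _) (Real.exp_pos _).le, ?_⟩
  rw [Real.exp_neg, ← div_eq_mul_inv, div_le_iff₀ (Real.exp_pos t)]
  exact Chebyshev.psi_le_const_mul_self (Real.exp_pos t).le

theorem abs_psi_exp_mul_exp_neg_sub_one_le (t : ℝ) :
    |Chebyshev.psi (Real.exp t) * Real.exp (-t) - 1| ≤ Real.log 4 + 4 := by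
  have h := psi_exp_mul_exp_neg_mem t
  have h4 : 0 ≤ Real.log 4 := Real.log_nonneg (by norm_num)
  exact abs_le.2 ⟨by linarith, by linarith⟩

theorem measurable_psi_exp_mul_exp_neg :
    Measurable fun t : ℝ => Chebyshev.psi (Real.exp t) * Real.exp (-t) :=
  (Chebyshev.psi_mono.measurable.comp Real.measurable_exp).mul (by fun_prop)

/-- Mellin's formula `-ζ'/ζ (s) = s ∫ ψ(x) x ^ (-s - 1) dx`, in the variable `t = log x`. -/
theorem LSeries_vonMangoldt_eq_mul_integral_psi_exp {s : ℂ} (hs : 0 < s.re) :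
    LSeries (fun n => (ArithmeticFunction.vonMangoldt n : ℂ)) (1 + s) =
      (1 + s) * ∫ t in Set.Ioi (0 : ℝ),
        ((Chebyshev.psi (Real.exp t) * Real.exp (-t) : ℝ) : ℂ) * Complex.exp (-s * t) := by
  have hO : (fun n : ℕ => ∑ k ∈ Finset.Icc 1 n, ArithmeticFunction.vonMangoldt k) =O[atTop]
      fun n => (n : ℝ) ^ (1 : ℝ) := by
    refine IsBigO.of_bound (Real.log 4 + 4) (Eventually.of_forall fun n => ?_)
    have hpsi : ∑ k ∈ Finset.Icc 1 n, ArithmeticFunction.vonMangoldt k = Chebyshev.psi n := by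
      rw [Chebyshev.psi, Nat.floor_natCast]
      rfl
    rw [hpsi, Real.rpow_one, Real.norm_of_nonneg (Chebyshev.psi_nonneg _),
      Real.norm_of_nonneg n.cast_nonneg]
    exact Chebyshev.psi_le_const_mul_self n.cast_nonneg
  rw [LSeries_eq_mul_integral_of_nonneg (fun n => ArithmeticFunction.vonMangoldt n) zero_le_one
    (by simpa using hs) hO fun _ => ArithmeticFunction.vonMangoldt_nonneg]
  congr 1
  rw [integral_Ioi_one_eq_integral_exp_smul]
  refine integral_congr_ae (ae_of_all _ fun t => ?_)
  have hpsi : (∑ k ∈ Finset.Icc 1 ⌊Real.exp t⌋₊, (ArithmeticFunction.vonMangoldt k : ℂ)) =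
      (Chebyshev.psi (Real.exp t) : ℂ) := by
    rw [Chebyshev.psi, Complex.ofReal_sum]
    rfl
  simp only
  rw [hpsi, Complex.real_smul, Complex.cpow_def_of_ne_zero (by simp),
    ← Complex.ofReal_log (Real.exp_pos t).le, Real.log_exp]
  push_cast
  rw [mul_left_comm, mul_assoc, ← Complex.exp_add, ← Complex.exp_add]
  congr 2
  ring

/-- The Laplace transform of `ψ(exp t) exp (-t) - 1` extends continuously to the closed half
plane, because `ζ` has no zeros on the line `re s = 1`. -/
theorem integral_psi_exp_sub_one {s : ℂ} (hs : 0 < s.re) :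
    ∫ t in Set.Ioi (0 : ℝ),
        ((Chebyshev.psi (Real.exp t) * Real.exp (-t) - 1 : ℝ) : ℂ) * Complex.exp (-s * t) =
      (negLogDerivZetaRegular (1 + s) - 1) / (1 + s) := by
  have hre : (-s).re < 0 := by simpa using hs
  have hexp := integrableOn_exp_mul_complex_Ioi hre 0
  have hs0 : s ≠ 0 := by
    rintro rfl
    simp at hs
  have hs1 : 1 + s ≠ 0 := by
    intro h
    have := congrArg Complex.re h
    simp at this
    linarith
  have hint : IntegrableOn (fun t : ℝ =>
      ((Chebyshev.psi (Real.exp t) * Real.exp (-t) : ℝ) : ℂ) * Complex.exp (-s * t))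
      (Set.Ioi 0) := by
    refine Integrable.bdd_mul (c := Real.log 4 + 4) hexp
      (Complex.measurable_ofReal.comp measurable_psi_exp_mul_exp_neg).aestronglyMeasurable
      (ae_of_all _ fun t => ?_)
    have h := psi_exp_mul_exp_neg_mem t
    rw [Complex.norm_real, Real.norm_of_nonneg h.1]
    exact h.2
  have hsplit (t : ℝ) : ((Chebyshev.psi (Real.exp t) * Real.exp (-t) - 1 : ℝ) : ℂ) *
      Complex.exp (-s * t) = ((Chebyshev.psi (Real.exp t) * Real.exp (-t) : ℝ) : ℂ) *
      Complex.exp (-s * t) - Complex.exp (-s * t) := by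
    push_cast
    ring
  simp_rw [hsplit]
  have hL := LSeries_vonMangoldt_eq_mul_integral_psi_exp hs
  rw [LSeries_vonMangoldt_eq_inv_sub_add (by simpa using hs), add_sub_cancel_left] at hL
  rw [integral_sub hint hexp, integral_exp_mul_complex_Ioi hre,
    eq_div_iff hs1, sub_mul, mul_comm _ (1 + s), ← hL]
  simp
  field_simp
  ring

/-- The prime number theorem for `ψ`, in the variable `t = log x`: Chebyshev's bound and the
monotonicity of `ψ` are the Tauberian conditions. -/
theorem tendsto_psi_exp_mul_exp_neg :
    Tendsto (fun t : ℝ => Chebyshev.psi (Real.exp t) * Real.exp (-t)) atTop (𝓝 1) := by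
  have hG : ContinuousOn (fun s : ℂ => (negLogDerivZetaRegular (1 + s) - 1) / (1 + s))
      {s | 0 ≤ s.re} := by
    refine ContinuousOn.div ?_ (by fun_prop) fun s (hs : 0 ≤ s.re) h => ?_
    · refine (continuousOn_negLogDerivZetaRegular.comp (by fun_prop) fun s hs => ?_).sub
        continuousOn_const
      simpa using hs
    · have := congrArg Complex.re h
      simp at this
      linarith
  refine tendsto_one_of_tendsto_fejer_average measurable_psi_exp_mul_exp_neg
    abs_psi_exp_mul_exp_neg_sub_one_le (fun t => (psi_exp_mul_exp_neg_mem t).1) ?_ fun l hl =>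
      tendsto_integral_mul_fejerKernel (measurable_psi_exp_mul_exp_neg.sub_const 1)
        abs_psi_exp_mul_exp_neg_sub_one_le hG (fun s hs => integral_psi_exp_sub_one hs) hl
  intro s t hst
  simp only [mul_assoc, ← Real.exp_add, neg_add_cancel, Real.exp_zero, mul_one]
  exact Chebyshev.psi_mono (Real.exp_le_exp.2 hst)

theorem tendsto_psi_div : Tendsto (fun x : ℝ => Chebyshev.psi x / x) atTop (𝓝 1) := by
  refine (tendsto_psi_exp_mul_exp_neg.comp Real.tendsto_log_atTop).congr' ?_
  filter_upwards [eventually_gt_atTop 0] with x hx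
  rw [Function.comp_apply, Real.exp_neg, Real.exp_log hx, div_eq_mul_inv]

theorem tendsto_theta_div : Tendsto (fun x : ℝ => Chebyshev.theta x / x) atTop (𝓝 1) := by
  have h1 : (Chebyshev.psi - Chebyshev.theta) =o[atTop] fun x : ℝ => x := by
    refine Chebyshev.isBigO_psi_sub_theta_sqrt.trans_isLittleO ?_
    rw [isLittleO_iff_tendsto' (by filter_upwards [eventually_gt_atTop 0] with x hx h
                                   exact absurd h hx.ne')]
    simpa only [Real.sqrt_div_self, Function.comp_def] using
      tendsto_inv_atTop_zero.comp Real.tendsto_sqrt_atTop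
  have h2 := tendsto_psi_div.sub h1.tendsto_div_nhds_zero
  rw [sub_zero] at h2
  refine h2.congr fun x => ?_
  rw [Pi.sub_apply]
  ring

/-- The **prime number theorem**. -/
theorem tendsto_primeCounting_mul_log_div :
    Tendsto (fun n : ℕ => (Nat.primeCounting n : ℝ) / n * Real.log n) atTop (𝓝 1) := by
  have h0 : Tendsto (fun x : ℝ => (∫ t in (2 : ℝ)..x, Chebyshev.theta t / (t * Real.log t ^ 2)) /
      (x / Real.log x)) atTop (𝓝 0) :=
    Chebyshev.integral_theta_div_log_sq_isLittleO.tendsto_div_nhds_zero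
  have h1 := (tendsto_theta_div.add h0).comp tendsto_natCast_atTop_atTop
  rw [add_zero] at h1
  refine h1.congr' ?_
  filter_upwards [eventually_ge_atTop 2] with n hn
  have hn' : (2 : ℝ) ≤ n := by exact_mod_cast hn
  have hlog : Real.log n ≠ 0 := (Real.log_pos (by linarith)).ne'
  have hmain := Chebyshev.primeCounting_eq_theta_div_log_add_integral hn'
  rw [Nat.floor_natCast] at hmain
  rw [Function.comp_apply, hmain]
  field_simp

/-! ### Mertens' first and second theorems -/

/-- The sum `∑ log p / p` over the primes `p ≤ x`. -/
noncomputable def primeLogSum (x : ℝ) : ℝ :=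
  ∑ p ∈ Nat.primesLE ⌊x⌋₊, Real.log p / p

/-- The sum `∑ 1 / p` over the primes `p ≤ x`. -/
noncomputable def primeRecipSum (x : ℝ) : ℝ :=
  ∑ p ∈ Nat.primesLE ⌊x⌋₊, 1 / (p : ℝ)

theorem monotone_primeLogSum : Monotone primeLogSum := fun _ _ h =>
  Finset.sum_le_sum_of_subset_of_nonneg (Nat.primesLE_mono (Nat.floor_mono h)) fun _ _ _ =>
    div_nonneg (Real.log_natCast_nonneg _) (Nat.cast_nonneg _)

theorem monotone_primeRecipSum : Monotone primeRecipSum := fun _ _ h =>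
  Finset.sum_le_sum_of_subset_of_nonneg (Nat.primesLE_mono (Nat.floor_mono h)) fun _ _ _ => by
    positivity

theorem primeRecipSum_nonneg (x : ℝ) : 0 ≤ primeRecipSum x :=
  Finset.sum_nonneg fun _ _ => by positivity

theorem log_factorial_eq_sum_primesLE (n : ℕ) :
    Real.log n.factorial = ∑ p ∈ Nat.primesLE n, n.factorial.factorization p * Real.log p := by
  rw [Real.log_nat_eq_sum_factorization]
  refine Finsupp.sum_of_support_subset _ (fun p hp => ?_) _ (by simp)
  rw [Nat.support_factorization] at hp
  have hp' := Nat.prime_of_mem_primeFactors hp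
  exact Nat.mem_primesLE.2 ⟨hp'.dvd_factorial.1 (Nat.dvd_of_mem_primeFactors hp), hp'⟩

theorem div_le_factorization_factorial {p : ℕ} (hp : p.Prime) (n : ℕ) :
    n / p ≤ n.factorial.factorization p := by
  rw [Nat.factorization_factorial hp (Nat.lt_succ_self (Nat.log p n))]
  rcases Nat.eq_zero_or_pos (n / p) with h | h
  · rw [h]
    exact Nat.zero_le _
  · have hpn : p ≤ n := by
      by_contra hlt
      rw [Nat.div_eq_of_lt (not_le.1 hlt)] at h
      exact lt_irrefl 0 h
    have h1 : 1 ≤ Nat.log p n := Nat.log_pos hp.one_lt hpn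
    have := Finset.single_le_sum (f := fun i => n / p ^ i) (s := Finset.Ico 1 (Nat.log p n).succ)
      (fun _ _ => Nat.zero_le _) (a := 1) (Finset.mem_Ico.2 ⟨le_rfl, by omega⟩)
    simpa using this

/-- From `log n!`, in which each prime `p` occurs with exponent at least `⌊n / p⌋`. -/
theorem primeLogSum_le_log_add {n : ℕ} (hn : n ≠ 0) :
    primeLogSum n ≤ Real.log n + Real.log 4 := by
  have hn0 : (0 : ℝ) < n := by exact_mod_cast Nat.pos_of_ne_zero hn
  have h1 : n * primeLogSum n - Chebyshev.theta n ≤ Real.log n.factorial := by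
    rw [log_factorial_eq_sum_primesLE, primeLogSum, Chebyshev.theta_eq_sum_primesLE_log,
      Nat.floor_natCast, Finset.mul_sum, ← Finset.sum_sub_distrib]
    refine Finset.sum_le_sum fun p hp => ?_
    have hpp := (Nat.mem_primesLE.1 hp).2
    have hp0 : (0 : ℝ) < p := by exact_mod_cast hpp.pos
    have h2 : (n : ℝ) / p - 1 ≤ n.factorial.factorization p := by
      have h3 : ((n / p : ℕ) : ℝ) ≤ n.factorial.factorization p := by
        exact_mod_cast div_le_factorization_factorial hpp n
      have h4 := Nat.lt_floor_add_one ((n : ℝ) / p)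
      rw [Nat.floor_div_eq_div] at h4
      linarith
    calc (n : ℝ) * (Real.log p / p) - Real.log p = ((n : ℝ) / p - 1) * Real.log p := by ring
      _ ≤ _ := mul_le_mul_of_nonneg_right h2 (Real.log_natCast_nonneg p)
  have h2 : Real.log n.factorial ≤ n * Real.log n := by
    rw [← Real.log_pow]
    exact Real.log_le_log (by exact_mod_cast n.factorial_pos)
      (by exact_mod_cast Nat.factorial_le_pow n)
  have h3 := Chebyshev.theta_le_log4_mul_x (x := n) hn0.le
  refine le_of_mul_le_mul_left ?_ hn0
  linarith

theorem log_div_mul_sub_one_nonneg (n : ℕ) : 0 ≤ Real.log n / (n * (n - 1)) := by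
  rcases Nat.eq_zero_or_pos n with rfl | hn
  · simp
  · have : (1 : ℝ) ≤ n := by exact_mod_cast hn
    exact div_nonneg (Real.log_natCast_nonneg n) (mul_nonneg (by linarith) (by linarith))

theorem summable_log_div_mul_sub_one :
    Summable fun n : ℕ => Real.log n / (n * (n - 1)) := by
  refine Summable.of_nonneg_of_le log_div_mul_sub_one_nonneg (fun n => ?_)
    ((Real.summable_nat_rpow (p := -(3 / 2))).2 (by norm_num) |>.mul_left 4)
  · rcases lt_or_ge n 2 with hn | hn
    · interval_cases n <;> simp
    · have hn2 : (2 : ℝ) ≤ n := by exact_mod_cast hn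
      have hn0 : (0 : ℝ) < n := by linarith
      have hlog := Real.log_le_rpow_div hn0.le (ε := 1 / 2) (by norm_num)
      rw [div_le_iff₀ (mul_pos hn0 (by linarith))]
      have hpow : (n : ℝ) ^ (-(3 / 2) : ℝ) * n ^ 2 = n ^ (1 / 2 : ℝ) := by
        rw [← Real.rpow_natCast, ← Real.rpow_add hn0]
        norm_num
      have hpos : (0 : ℝ) < (n : ℝ) ^ (-(3 / 2) : ℝ) := by positivity
      calc Real.log n ≤ 2 * (n : ℝ) ^ (1 / 2 : ℝ) := by linarith
        _ = (n : ℝ) ^ (-(3 / 2) : ℝ) * (2 * n ^ 2) := by rw [← hpow]; ring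
        _ ≤ (n : ℝ) ^ (-(3 / 2) : ℝ) * (4 * (n * (n - 1))) :=
            mul_le_mul_of_nonneg_left (by nlinarith) hpos.le
        _ = _ := by ring

/-- From `log n!`, in which each prime `p` occurs with exponent at most
`n / (p - 1) = n / p + n / (p * (p - 1))`. -/
theorem log_sub_le_primeLogSum {n : ℕ} (hn : n ≠ 0) :
    Real.log n - 1 - ∑' k : ℕ, Real.log k / (k * (k - 1)) ≤ primeLogSum n := by
  have hn0 : (0 : ℝ) < n := by exact_mod_cast Nat.pos_of_ne_zero hn
  have h1 : Real.log n.factorial ≤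
      n * (primeLogSum n + ∑ p ∈ Nat.primesLE n, Real.log p / (p * (p - 1))) := by
    rw [log_factorial_eq_sum_primesLE, primeLogSum, Nat.floor_natCast, ← Finset.sum_add_distrib,
      Finset.mul_sum]
    refine Finset.sum_le_sum fun p hp => ?_
    have hpp := (Nat.mem_primesLE.1 hp).2
    have hp2 : (2 : ℝ) ≤ p := by exact_mod_cast hpp.two_le
    have hp1 : (p : ℝ) - 1 ≠ 0 := by linarith
    have h2 : (n.factorial.factorization p : ℝ) ≤ n / (p - 1) := by
      refine (Nat.cast_le.2 (Nat.factorization_factorial_le_div_pred hpp n)).trans ?_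
      refine Nat.cast_div_le.trans_eq ?_
      rw [Nat.cast_sub hpp.one_le, Nat.cast_one]
    calc _ ≤ (n / (p - 1) : ℝ) * Real.log p :=
          mul_le_mul_of_nonneg_right h2 (Real.log_natCast_nonneg p)
      _ = _ := by field_simp; ring
  have h2 : ∑ p ∈ Nat.primesLE n, Real.log p / (p * (p - 1)) ≤
      ∑' k : ℕ, Real.log k / (k * (k - 1)) :=
    summable_log_div_mul_sub_one.sum_le_tsum _ fun k _ =>
      log_div_mul_sub_one_nonneg k
  have h3 : n * Real.log n - n ≤ Real.log n.factorial := by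
    have h := Real.log_le_log (by positivity) (Real.pow_div_factorial_le_exp (n : ℝ) hn0.le n)
    rw [Real.log_exp, Real.log_div (by positivity) (by positivity), Real.log_pow] at h
    linarith
  refine le_of_mul_le_mul_left ?_ hn0
  nlinarith [mul_le_mul_of_nonneg_left h2 hn0.le]

/-- **Mertens' first theorem**: `∑_{p ≤ x} log p / p = log x + O(1)`. -/
theorem exists_abs_primeLogSum_sub_log_le :
    ∃ C, ∀ x : ℝ, 2 ≤ x → |primeLogSum x - Real.log x| ≤ C := by
  refine ⟨Real.log 4 + (1 + ∑' k : ℕ, Real.log k / (k * (k - 1))) + Real.log 2, fun x hx => ?_⟩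
  have hx0 : 0 ≤ x := by linarith
  have hn : ⌊x⌋₊ ≠ 0 := (Nat.floor_pos.2 (by linarith)).ne'
  have hn1 : (1 : ℝ) ≤ (⌊x⌋₊ : ℝ) := by exact_mod_cast Nat.one_le_iff_ne_zero.2 hn
  have hfl : primeLogSum x = primeLogSum (⌊x⌋₊ : ℝ) := by
    rw [primeLogSum, primeLogSum, Nat.floor_natCast]
  have h1 := primeLogSum_le_log_add hn
  have h2 := log_sub_le_primeLogSum hn
  have h3 : Real.log (⌊x⌋₊ : ℝ) ≤ Real.log x :=
    Real.log_le_log (by linarith) (Nat.floor_le hx0)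
  have h4 : Real.log x ≤ Real.log 2 + Real.log (⌊x⌋₊ : ℝ) := by
    rw [← Real.log_mul two_ne_zero (by linarith)]
    exact Real.log_le_log (by linarith) (by linarith [Nat.lt_floor_add_one x])
  have h5 : 0 ≤ ∑' k : ℕ, Real.log k / (k * (k - 1)) := tsum_nonneg
    log_div_mul_sub_one_nonneg
  have h6 : 0 ≤ Real.log 4 := Real.log_nonneg (by norm_num)
  have h7 : 0 ≤ Real.log 2 := Real.log_nonneg (by norm_num)
  rw [hfl]
  exact abs_le.2 ⟨by linarith, by linarith⟩

/-- Abel summation with the weight `1 / log t`. -/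
theorem primeRecipSum_eq_primeLogSum_div_log_add_integral {x : ℝ} (hx : 2 ≤ x) :
    primeRecipSum x = primeLogSum x / Real.log x +
      ∫ t in (2 : ℝ)..x, primeLogSum t * (t⁻¹ / Real.log t ^ 2) := by
  let a : ℕ → ℝ := fun n => if n.Prime then Real.log n / n else 0
  have hlog {t : ℝ} (ht : 2 ≤ t) : Real.log t ≠ 0 := (Real.log_pos (by linarith)).ne'
  have ha (y : ℝ) : ∑ k ∈ Finset.Icc 0 ⌊y⌋₊, a k = primeLogSum y := by
    rw [primeLogSum, Nat.primesLE_eq_filter_Icc_zero, Finset.sum_filter]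
  have hleft : ∑ k ∈ Finset.Icc 0 ⌊x⌋₊, (Real.log k)⁻¹ * a k = primeRecipSum x := by
    rw [primeRecipSum, Nat.primesLE_eq_filter_Icc_zero, Finset.sum_filter]
    refine Finset.sum_congr rfl fun k _ => ?_
    simp only [a]
    split_ifs with hk
    · have : Real.log k ≠ 0 := hlog (by exact_mod_cast hk.two_le)
      field_simp
    · simp
  have hderiv : deriv (fun t : ℝ => (Real.log t)⁻¹) = fun t => -(t⁻¹ / Real.log t ^ 2) := by
    funext t
    rw [Real.deriv_inv_log_apply]
    ring
  rw [← hleft, sum_mul_eq_sub_integral_mul₁ a (f := fun t => (Real.log t)⁻¹)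
    (by simp [a, Nat.not_prime_zero]) (by simp [a, Nat.not_prime_one]) x ?_ ?_, ha,
    intervalIntegral.integral_of_le hx, hderiv]
  · simp_rw [ha, neg_mul, integral_neg]
    rw [sub_neg_eq_add, div_eq_mul_inv, mul_comm]
    simp_rw [mul_comm (primeLogSum _)]
  · intro t ht
    exact (Real.differentiableAt_log (by linarith [ht.1])).inv (hlog ht.1)
  · rw [hderiv]
    refine ContinuousOn.integrableOn_Icc fun t ht => ContinuousAt.continuousWithinAt ?_
    have h1 : t ≠ 0 := by linarith [ht.1]
    have h2 : Real.log t ^ 2 ≠ 0 := pow_ne_zero _ (hlog ht.1)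
    fun_prop (disch := assumption)

/-- **Mertens' second theorem**, with an unspecified constant: `∑_{p ≤ x} 1 / p - log log x`
converges. -/
theorem exists_tendsto_primeRecipSum_sub_log_log :
    ∃ M, Tendsto (fun x : ℝ => primeRecipSum x - Real.log (Real.log x)) atTop (𝓝 M) := by
  obtain ⟨C, hC⟩ := exists_abs_primeLogSum_sub_log_le
  -- The main term `log t` of `primeLogSum t` integrates to `log log x`; the remainder `r` is bounded
  -- and contributes an absolutely convergent integral.
  let r : ℝ → ℝ := fun t => primeLogSum t - Real.log t
  have hr : Measurable r := monotone_primeLogSum.measurable.sub Real.measurable_log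
  have hint : IntegrableOn (fun t => r t * (t⁻¹ / Real.log t ^ 2)) (Set.Ioi 2) := by
    refine Integrable.bdd_mul (c := C) (integrableOn_inv_div_log_sq_Ioi one_lt_two)
      hr.aestronglyMeasurable ?_
    filter_upwards [ae_restrict_mem measurableSet_Ioi] with t ht
    exact hC t (le_of_lt ht)
  have h1 : Tendsto (fun x => r x / Real.log x) atTop (𝓝 0) := by
    refine squeeze_zero_norm' ?_ (tendsto_const_nhds.div_atTop Real.tendsto_log_atTop (a := C))
    filter_upwards [eventually_ge_atTop 2] with x hx
    have hlog : 0 < Real.log x := Real.log_pos (by linarith)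
    rw [norm_div, Real.norm_of_nonneg hlog.le]
    exact div_le_div_of_nonneg_right (hC x hx) hlog.le
  have h2 := intervalIntegral_tendsto_integral_Ioi 2 hint tendsto_id
  refine ⟨_, ((h1.const_add (1 - Real.log (Real.log 2))).add h2).congr' ?_⟩
  filter_upwards [eventually_ge_atTop 2] with x hx
  have hlog : Real.log x ≠ 0 := (Real.log_pos (by linarith)).ne'
  have hmem {t : ℝ} (ht : t ∈ Set.uIcc 2 x) : 2 ≤ t := by
    rw [Set.uIcc_of_le hx] at ht
    exact ht.1
  have hsplit : ∫ t in (2 : ℝ)..x, primeLogSum t * (t⁻¹ / Real.log t ^ 2) =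
      (∫ t in (2 : ℝ)..x, t⁻¹ / Real.log t) +
        ∫ t in (2 : ℝ)..x, r t * (t⁻¹ / Real.log t ^ 2) := by
    rw [← intervalIntegral.integral_add]
    · refine intervalIntegral.integral_congr fun t ht => ?_
      have h0 := hmem ht
      have h1 : t ≠ 0 := by linarith
      have h2 : Real.log t ≠ 0 := (Real.log_pos (by linarith)).ne'
      simp only [r]
      field_simp
      ring
    · refine ContinuousOn.intervalIntegrable fun t ht => ContinuousAt.continuousWithinAt ?_
      have h0 := hmem ht
      have h1 : t ≠ 0 := by linarith
      have h2 : Real.log t ≠ 0 := (Real.log_pos (by linarith)).ne'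
      fun_prop (disch := assumption)
    · rw [intervalIntegrable_iff_integrableOn_Ioc_of_le hx]
      exact hint.mono_set Set.Ioc_subset_Ioi_self
  rw [primeRecipSum_eq_primeLogSum_div_log_add_integral hx, hsplit, integral_inv_div_log one_lt_two (by linarith)]
  simp only [r, id]
  field_simp
  ring

/-- The difference in Mertens' second theorem is bounded from `2` on. -/
theorem exists_abs_primeRecipSum_sub_log_log_le :
    ∃ C, ∀ x : ℝ, 2 ≤ x → |primeRecipSum x - Real.log (Real.log x)| ≤ C := by
  obtain ⟨M, hM⟩ := exists_tendsto_primeRecipSum_sub_log_log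
  obtain ⟨X, hX⟩ := eventually_atTop.1 (hM.abs.eventually_le_const (lt_add_one |M|))
  refine ⟨|M| + 1 + primeRecipSum X + |Real.log (Real.log 2)| + |Real.log (Real.log X)|,
    fun x hx => ?_⟩
  have hB := primeRecipSum_nonneg X
  have hBx := primeRecipSum_nonneg x
  have hl2 : 0 < Real.log 2 := Real.log_pos one_lt_two
  rcases le_total X x with h | h
  · linarith [hX x h, abs_nonneg (Real.log (Real.log 2)), abs_nonneg (Real.log (Real.log X))]
  · have h1 := monotone_primeRecipSum h
    have h2 : Real.log (Real.log 2) ≤ Real.log (Real.log x) :=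
      Real.log_le_log hl2 (Real.log_le_log two_pos hx)
    have h3 : Real.log (Real.log x) ≤ Real.log (Real.log X) :=
      Real.log_le_log (Real.log_pos (by linarith)) (Real.log_le_log (by linarith) h)
    have h4 := neg_abs_le (Real.log (Real.log 2))
    have h5 := le_abs_self (Real.log (Real.log X))
    have h6 := abs_nonneg (Real.log (Real.log X))
    have h7 := abs_nonneg (Real.log (Real.log 2))
    have h8 := abs_nonneg M
    exact abs_le.2 ⟨by linarith, by linarith⟩

/-! ### Mertens' third theorem -/

/-- The integral representation of `Γ'(1) = -γ`. -/
theorem integral_log_mul_exp_neg :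
    ∫ v in Set.Ioi (0 : ℝ), Real.log v * Real.exp (-v) = -Real.eulerMascheroniConstant := by
  have h1 := Complex.hasDerivAt_GammaIntegral (s := 1) (by simp)
  have h2 : HasDerivAt Complex.GammaIntegral (-Real.eulerMascheroniConstant : ℂ) 1 := by
    refine Complex.hasDerivAt_Gamma_one.congr_of_eventuallyEq ?_
    have : ∀ᶠ s : ℂ in 𝓝 1, 0 < s.re :=
      (Complex.continuous_re.tendsto 1).eventually_const_lt (by simp)
    filter_upwards [this] with s hs
    exact (Complex.Gamma_eq_integral hs).symm
  have h3 := h1.unique h2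
  simp only [sub_self, Complex.cpow_zero, one_mul] at h3
  apply Complex.ofReal_injective
  rw [← integral_complex_ofReal, Complex.ofReal_neg, ← h3]
  exact integral_congr_ae (ae_of_all _ fun v => by simp only; push_cast; rfl)

theorem integrableOn_log_mul_exp_neg :
    IntegrableOn (fun v => Real.log v * Real.exp (-v)) (Set.Ioi 0) := by
  -- The integral of a non-integrable function is `0` by convention, whereas `γ ≠ 0`.
  by_contra h
  have h1 := integral_log_mul_exp_neg
  rw [integral_undef h] at h1
  linarith [Real.one_half_lt_eulerMascheroniConstant]

theorem isBigO_sum_prime_recip {r : ℝ} (hr : 0 < r) :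
    (fun n : ℕ => ∑ k ∈ Finset.Icc 1 n, if k.Prime then 1 / (k : ℝ) else 0) =O[atTop]
      fun n => (n : ℝ) ^ r := by
  have h1 : (fun n : ℕ => ∑ k ∈ Finset.Icc 1 n, if k.Prime then 1 / (k : ℝ) else 0) =O[atTop]
      fun n : ℕ => 1 + Real.log n := by
    refine IsBigO.of_bound 1 (Eventually.of_forall fun n => ?_)
    have h0 : ∑ k ∈ Finset.Icc 1 n, (if k.Prime then 1 / (k : ℝ) else 0) ≤ harmonic n := by
      rw [harmonic_eq_sum_Icc]
      push_cast
      refine Finset.sum_le_sum fun k _ => ?_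
      split_ifs
      · rw [one_div]
      · positivity
    have h0' : 0 ≤ ∑ k ∈ Finset.Icc 1 n, (if k.Prime then 1 / (k : ℝ) else 0) :=
      Finset.sum_nonneg fun k _ => by positivity
    have h2 := harmonic_le_one_add_log n
    rw [Real.norm_of_nonneg h0', Real.norm_of_nonneg (by linarith), one_mul]
    linarith
  have h2 : (fun x : ℝ => 1 + Real.log x) =O[atTop] fun x => x ^ r :=
    ((isLittleO_const_left.2 (Or.inr
      (tendsto_norm_atTop_atTop.comp (tendsto_rpow_atTop hr)))).isBigO).add
      (isLittleO_log_rpow_atTop hr).isBigO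
  exact h1.trans (h2.comp_tendsto tendsto_natCast_atTop_atTop)

/-- The prime zeta function at `1 + δ` as an exponential average of `∑_{p ≤ x} 1 / p`. -/
theorem tsum_prime_rpow_eq_integral {δ : ℝ} (hδ : 0 < δ) :
    ∑' p : Nat.Primes, ((p : ℕ) : ℝ) ^ (-(1 + δ)) =
      ∫ v in Set.Ioi (0 : ℝ), primeRecipSum (Real.exp (v / δ)) * Real.exp (-v) := by
  let f : ℕ → ℝ := fun k => if k.Prime then 1 / (k : ℝ) else 0
  have hf0 : ((f 0 : ℝ) : ℂ) = 0 := by simp [f, Nat.not_prime_zero]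
  have hLS := LSeries_eq_mul_integral_of_nonneg f (r := δ / 2) (s := δ) (by linarith)
    (by simpa using hδ) (isBigO_sum_prime_recip (by linarith)) fun n => by positivity
  have hsum : ∑' p : Nat.Primes, ((p : ℕ) : ℝ) ^ (-(1 + δ)) = ∑' n : ℕ, f n / (n : ℝ) ^ δ := by
    refine (tsum_subtype {p : ℕ | p.Prime} fun n : ℕ => (n : ℝ) ^ (-(1 + δ))).trans
      (tsum_congr fun n => ?_)
    by_cases hn : n.Prime
    · have hn0 : (0 : ℝ) < n := by exact_mod_cast hn.pos
      rw [Set.indicator_of_mem (by exact hn), neg_add, Real.rpow_add hn0, Real.rpow_neg_one,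
        Real.rpow_neg hn0.le]
      simp only [f, if_pos hn]
      field_simp
    · rw [Set.indicator_of_notMem (by exact hn)]
      simp [f, hn]
  have hleft : LSeries (fun n => (f n : ℂ)) δ = ((∑' n : ℕ, f n / (n : ℝ) ^ δ : ℝ) : ℂ) := by
    rw [LSeries_def₀ hf0, Complex.ofReal_tsum]
    refine tsum_congr fun n => ?_
    rw [Complex.ofReal_div, Complex.ofReal_cpow n.cast_nonneg, Complex.ofReal_natCast]
  have hright : ∫ t in Set.Ioi (1 : ℝ),
      (∑ k ∈ Finset.Icc 1 ⌊t⌋₊, (f k : ℂ)) * (t : ℂ) ^ (-((δ : ℂ) + 1)) =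
      ((∫ t in Set.Ioi (1 : ℝ), primeRecipSum t * t ^ (-(δ + 1)) : ℝ) : ℂ) := by
    rw [← integral_complex_ofReal]
    refine setIntegral_congr_fun measurableSet_Ioi fun t (ht : 1 < t) => ?_
    rw [Complex.ofReal_mul, Complex.ofReal_cpow (by linarith), primeRecipSum,
      Nat.primesLE_eq_filter_Icc_one, Finset.sum_filter, Complex.ofReal_sum]
    push_cast
    rfl
  rw [hleft, hright, ← Complex.ofReal_mul] at hLS
  rw [hsum, Complex.ofReal_injective hLS, integral_Ioi_one_eq_integral_exp_smul]
  have hscale := integral_comp_mul_left_Ioi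
    (fun v => primeRecipSum (Real.exp (v / δ)) * Real.exp (-v)) 0 hδ
  rw [mul_zero, smul_eq_mul] at hscale
  rw [← mul_inv_cancel_left₀ hδ.ne' (∫ v in Set.Ioi (0 : ℝ),
    primeRecipSum (Real.exp (v / δ)) * Real.exp (-v)), ← hscale]
  congr 1
  refine integral_congr_ae (ae_of_all _ fun u => ?_)
  simp only [smul_eq_mul]
  rw [mul_div_cancel_left₀ _ hδ.ne', ← Real.exp_mul, mul_left_comm, ← Real.exp_add]
  congr 2
  ring

theorem primeRecipSum_of_lt_two {x : ℝ} (hx : x < 2) : primeRecipSum x = 0 := by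
  have h : ⌊x⌋₊ < 2 := (Nat.floor_lt' two_ne_zero).2 hx
  rw [primeRecipSum]
  refine Finset.sum_eq_zero fun p hp => ?_
  have := Nat.mem_primesLE.1 hp
  exact absurd this.2.two_le (by omega)

/-- An Abelian theorem: if `∑_{p ≤ x} 1 / p - log log x` tends to `M`, then its exponential average
also does; averaging the term `log log x` produces `Γ'(1) = -γ`. -/
theorem tendsto_tsum_prime_rpow_add_log {M : ℝ}
    (hM : Tendsto (fun x : ℝ => primeRecipSum x - Real.log (Real.log x)) atTop (𝓝 M)) :
    Tendsto (fun δ : ℝ => ∑' p : Nat.Primes, ((p : ℕ) : ℝ) ^ (-(1 + δ)) + Real.log δ) (𝓝[>] 0)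
      (𝓝 (M - Real.eulerMascheroniConstant)) := by
  obtain ⟨C, hC⟩ := exists_abs_primeRecipSum_sub_log_log_le
  have hC0 : 0 ≤ C := (abs_nonneg _).trans (hC 2 le_rfl)
  have hlogint := integrableOn_log_mul_exp_neg
  have hexpint := integrableOn_exp_neg_Ioi 0
  have hmeas (δ : ℝ) : Measurable fun v : ℝ =>
      (primeRecipSum (Real.exp (v / δ)) - Real.log (v / δ)) * Real.exp (-v) := by
    have := monotone_primeRecipSum.measurable
    fun_prop
  have hbound (δ v : ℝ) (hδ : 0 < δ) (hδ1 : δ ≤ 1) (hv : 0 < v) :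
      ‖(primeRecipSum (Real.exp (v / δ)) - Real.log (v / δ)) * Real.exp (-v)‖ ≤
        (C + |Real.log v|) * Real.exp (-v) := by
    rw [norm_mul, Real.norm_of_nonneg (Real.exp_pos (-v)).le, Real.norm_eq_abs]
    refine mul_le_mul_of_nonneg_right ?_ (Real.exp_pos _).le
    rcases le_or_gt 2 (Real.exp (v / δ)) with h | h
    · have := hC _ h
      rw [Real.log_exp] at this
      linarith [abs_nonneg (Real.log v)]
    · -- Here `v ≤ v / δ < log 2 < 1`, so that `|log (v / δ)| ≤ |log v|`.
      have h1 : v / δ < 1 := by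
        have := (Real.lt_log_iff_exp_lt two_pos).2 h
        linarith [Real.log_two_lt_d9]
      have h2 : v ≤ v / δ := le_div_self hv.le hδ hδ1
      have h3 : Real.log v ≤ Real.log (v / δ) := Real.log_le_log hv h2
      have h4 : Real.log (v / δ) ≤ 0 := Real.log_nonpos (by positivity) h1.le
      rw [primeRecipSum_of_lt_two h, zero_sub, abs_neg, abs_of_nonpos h4,
        abs_of_nonpos (h3.trans h4)]
      linarith
  have hdom : IntegrableOn (fun v => (C + |Real.log v|) * Real.exp (-v)) (Set.Ioi 0) := by
    simp_rw [add_mul]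
    refine (hexpint.const_mul C).add ?_
    refine hlogint.norm.congr (ae_of_all _ fun v => ?_)
    simp only
    rw [norm_mul, Real.norm_of_nonneg (Real.exp_pos (-v)).le, Real.norm_eq_abs]
  have hle1 : ∀ᶠ δ : ℝ in 𝓝[>] 0, δ ≤ 1 := nhdsWithin_le_nhds (eventually_le_nhds zero_lt_one)
  have hlim : Tendsto (fun δ : ℝ => ∫ v in Set.Ioi (0 : ℝ),
      (primeRecipSum (Real.exp (v / δ)) - Real.log (v / δ)) * Real.exp (-v)) (𝓝[>] 0)
      (𝓝 (∫ v in Set.Ioi (0 : ℝ), M * Real.exp (-v))) := by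
    refine tendsto_integral_filter_of_dominated_convergence _
      (Eventually.of_forall fun δ => (hmeas δ).aestronglyMeasurable) ?_ hdom ?_
    · filter_upwards [self_mem_nhdsWithin, hle1] with δ hδ hδ1
      filter_upwards [ae_restrict_mem measurableSet_Ioi] with v hv
      exact hbound δ v hδ hδ1 hv
    · filter_upwards [ae_restrict_mem measurableSet_Ioi] with v (hv : 0 < v)
      refine Tendsto.mul_const _ ?_
      have h1 : Tendsto (fun δ : ℝ => v / δ) (𝓝[>] 0) atTop :=
        (tendsto_inv_nhdsGT_zero.const_mul_atTop hv).congr fun δ => (div_eq_mul_inv v δ).symm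
      refine (hM.comp (Real.tendsto_exp_atTop.comp h1)).congr fun δ => ?_
      simp only [Function.comp_apply, Real.log_exp]
  rw [integral_const_mul, integral_exp_neg_Ioi_zero, mul_one] at hlim
  refine (hlim.sub_const Real.eulerMascheroniConstant).congr' ?_
  filter_upwards [self_mem_nhdsWithin, hle1] with δ (hδ : 0 < δ) hδ1
  have hint1 : IntegrableOn (fun v =>
      (primeRecipSum (Real.exp (v / δ)) - Real.log (v / δ)) * Real.exp (-v)) (Set.Ioi 0) := by
    refine Integrable.mono' hdom (hmeas δ).aestronglyMeasurable ?_
    filter_upwards [ae_restrict_mem measurableSet_Ioi] with v hv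
    exact hbound δ v hδ hδ1 hv
  have hint2 : IntegrableOn (fun v => Real.log v * Real.exp (-v) - Real.log δ * Real.exp (-v))
      (Set.Ioi 0) := hlogint.sub (hexpint.const_mul _)
  have hsplit : ∫ v in Set.Ioi (0 : ℝ), primeRecipSum (Real.exp (v / δ)) * Real.exp (-v) =
      ∫ v in Set.Ioi (0 : ℝ),
        ((primeRecipSum (Real.exp (v / δ)) - Real.log (v / δ)) * Real.exp (-v) +
          (Real.log v * Real.exp (-v) - Real.log δ * Real.exp (-v))) := by
    refine setIntegral_congr_fun measurableSet_Ioi fun v (hv : 0 < v) => ?_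
    rw [Real.log_div hv.ne' hδ.ne']
    ring
  rw [tsum_prime_rpow_eq_integral hδ, hsplit,
    integral_add hint1 hint2, integral_sub hlogint (hexpint.const_mul _), integral_log_mul_exp_neg, integral_const_mul,
    integral_exp_neg_Ioi_zero]
  ring

/-- The part of `-log (1 - y)` beyond first order: the contribution of the higher powers of a prime
to the logarithm of an Euler factor. -/
noncomputable def logRemainder (y : ℝ) : ℝ :=
  -Real.log (1 - y) - y

theorem abs_logRemainder_le {y : ℝ} (h0 : 0 ≤ y) (h1 : y ≤ 1 / 2) :
    |logRemainder y| ≤ 2 * y ^ 2 := by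
  have hy : |y| < 1 := by
    rw [abs_of_nonneg h0]
    linarith
  have h := Real.abs_log_sub_add_sum_range_le hy 1
  simp only [Finset.sum_range_one, zero_add, pow_one, Nat.cast_zero, div_one, one_add_one_eq_two,
    abs_of_nonneg h0] at h
  rw [logRemainder, ← abs_neg, show -(-Real.log (1 - y) - y) = y + Real.log (1 - y) by ring]
  refine h.trans ?_
  rw [div_le_iff₀ (by linarith)]
  nlinarith [sq_nonneg y]

theorem prime_rpow_neg_le {p : Nat.Primes} {s : ℝ} (hs : 1 ≤ s) :
    ((p : ℕ) : ℝ) ^ (-s) ≤ 1 / ((p : ℕ) : ℝ) := by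
  have hp : (1 : ℝ) ≤ ((p : ℕ) : ℝ) := by exact_mod_cast p.2.one_le
  rw [one_div, ← Real.rpow_neg_one]
  exact Real.rpow_le_rpow_of_exponent_le hp (by linarith)

theorem one_div_prime_le (p : Nat.Primes) : 1 / ((p : ℕ) : ℝ) ≤ 1 / 2 :=
  one_div_le_one_div_of_le two_pos (by exact_mod_cast p.2.two_le)

theorem summable_two_mul_one_div_prime_sq :
    Summable fun p : Nat.Primes => 2 * (1 / ((p : ℕ) : ℝ)) ^ 2 := by
  refine Summable.mul_left 2 (((Nat.Primes.summable_rpow (r := -2)).2 (by norm_num)).congr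
    fun p => ?_)
  rw [Real.rpow_neg (Nat.cast_nonneg _), one_div, inv_pow, Real.rpow_two]

theorem abs_logRemainder_prime_le (p : Nat.Primes) {s : ℝ} (hs : 1 ≤ s) :
    |logRemainder (((p : ℕ) : ℝ) ^ (-s))| ≤ 2 * (1 / ((p : ℕ) : ℝ)) ^ 2 := by
  have h := prime_rpow_neg_le (p := p) hs
  have h0 : 0 ≤ ((p : ℕ) : ℝ) ^ (-s) := by positivity
  refine (abs_logRemainder_le h0 (h.trans (one_div_prime_le p))).trans ?_
  gcongr

theorem summable_logRemainder_prime {s : ℝ} (hs : 1 ≤ s) :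
    Summable fun p : Nat.Primes => logRemainder (((p : ℕ) : ℝ) ^ (-s)) :=
  Summable.of_norm_bounded summable_two_mul_one_div_prime_sq fun p =>
    abs_logRemainder_prime_le p hs

/-- The logarithm of the Euler product. -/
theorem log_riemannZeta_eq_tsum_prime {s : ℝ} (hs : 1 < s) :
    Real.log (riemannZeta s).re = ∑' p : Nat.Primes, ((p : ℕ) : ℝ) ^ (-s) +
      ∑' p : Nat.Primes, logRemainder (((p : ℕ) : ℝ) ^ (-s)) := by
  rw [← Summable.tsum_add (Nat.Primes.summable_rpow.2 (by linarith))
    (summable_logRemainder_prime hs.le), ← riemannZeta_eulerProduct_exp_log (by simpa using hs)]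
  have hterm (p : Nat.Primes) : -Complex.log (1 - (p : ℂ) ^ (-(s : ℂ))) =
      ((((p : ℕ) : ℝ) ^ (-s) + logRemainder (((p : ℕ) : ℝ) ^ (-s)) : ℝ) : ℂ) := by
    have h := (prime_rpow_neg_le (p := p) hs.le).trans (one_div_prime_le p)
    rw [logRemainder, add_sub_cancel, Complex.ofReal_neg, Complex.ofReal_log (by linarith),
      Complex.ofReal_sub, Complex.ofReal_cpow (Nat.cast_nonneg _)]
    push_cast
    rfl
  simp_rw [hterm]
  rw [← Complex.ofReal_tsum, Complex.exp_ofReal_re, Real.log_exp]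

theorem tendsto_tsum_logRemainder_prime :
    Tendsto (fun δ : ℝ => ∑' p : Nat.Primes, logRemainder (((p : ℕ) : ℝ) ^ (-(1 + δ)))) (𝓝[>] 0)
      (𝓝 (∑' p : Nat.Primes, logRemainder (1 / ((p : ℕ) : ℝ)))) := by
  refine tendsto_tsum_of_dominated_convergence summable_two_mul_one_div_prime_sq (fun p => ?_) ?_
  · have hp : ((p : ℕ) : ℝ) ≠ 0 := by exact_mod_cast p.2.ne_zero
    have h1 : Tendsto (fun δ : ℝ => ((p : ℕ) : ℝ) ^ (-(1 + δ))) (𝓝 0)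
        (𝓝 (((p : ℕ) : ℝ) ^ (-(1 + 0) : ℝ))) :=
      ((Real.continuous_const_rpow hp).comp
        (by fun_prop : Continuous fun δ : ℝ => -(1 + δ))).tendsto 0
    rw [add_zero, Real.rpow_neg_one, ← one_div] at h1
    have hlt := one_div_prime_le p
    have h2 : ContinuousAt logRemainder (1 / ((p : ℕ) : ℝ)) := by
      have : 1 - 1 / ((p : ℕ) : ℝ) ≠ 0 := by linarith
      unfold logRemainder
      fun_prop (disch := assumption)
    exact h2.tendsto.comp (h1.mono_left nhdsWithin_le_nhds)
  · filter_upwards [self_mem_nhdsWithin] with δ (hδ : 0 < δ) p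
    exact abs_logRemainder_prime_le p (by linarith)

/-- The constants of Mertens' theorems: comparing with `log ζ(1 + δ) = -log δ + o(1)` identifies
the limit in the second theorem. -/
theorem tendsto_primeRecipSum_sub_log_log :
    Tendsto (fun x : ℝ => primeRecipSum x - Real.log (Real.log x)) atTop
      (𝓝 (Real.eulerMascheroniConstant -
        ∑' p : Nat.Primes, logRemainder (1 / ((p : ℕ) : ℝ)))) := by
  obtain ⟨M, hM⟩ := exists_tendsto_primeRecipSum_sub_log_log
  have h1 := (tendsto_tsum_prime_rpow_add_log hM).add tendsto_tsum_logRemainder_prime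
  have hshift : Tendsto (fun δ : ℝ => 1 + δ) (𝓝[>] 0) (𝓝[>] 1) := by
    refine tendsto_nhdsWithin_iff.2 ⟨?_, ?_⟩
    · exact ((by fun_prop : Continuous fun δ : ℝ => 1 + δ).tendsto' 0 1 (by simp)).mono_left
        nhdsWithin_le_nhds
    · filter_upwards [self_mem_nhdsWithin] with δ (hδ : 0 < δ)
      simpa using hδ
  have h2 := ((isLittleO_one_iff ℝ).1
    log_riemannZeta_add_log_sub_isLittleO_ofReal).comp hshift
  have h3 := tendsto_nhds_unique (h1.congr' ?_) h2
  · rwa [show Real.eulerMascheroniConstant -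
      ∑' p : Nat.Primes, logRemainder (1 / ((p : ℕ) : ℝ)) = M by linarith]
  · filter_upwards [self_mem_nhdsWithin] with δ (hδ : 0 < δ)
    rw [Function.comp_apply, log_riemannZeta_eq_tsum_prime (by linarith), add_sub_cancel_left]
    ring

theorem tendsto_sum_primesLE_logRemainder :
    Tendsto (fun x : ℝ => ∑ p ∈ Nat.primesLE ⌊x⌋₊, logRemainder (1 / (p : ℝ))) atTop
      (𝓝 (∑' p : Nat.Primes, logRemainder (1 / ((p : ℕ) : ℝ)))) := by
  have hs : Summable fun p : Nat.Primes => logRemainder (1 / ((p : ℕ) : ℝ)) :=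
    (summable_logRemainder_prime le_rfl).congr fun p => by rw [Real.rpow_neg_one, one_div]
  have hs' : HasSum ({p : ℕ | p.Prime}.indicator fun n => logRemainder (1 / (n : ℝ)))
      (∑' p : Nat.Primes, logRemainder (1 / ((p : ℕ) : ℝ))) :=
    (hasSum_subtype_iff_indicator (s := {p : ℕ | p.Prime})).1 hs.hasSum
  refine (hs'.tendsto_sum_nat.comp
    ((tendsto_add_atTop_nat 1).comp tendsto_nat_floor_atTop)).congr fun x => ?_
  rw [Function.comp_apply, Function.comp_apply, Nat.primesLE_eq_filter_range, Finset.sum_filter]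
  classical
  exact Finset.sum_congr rfl fun k _ => by simp [Set.indicator_apply]

/-- **Mertens' third theorem**: `∏_{p ≤ x} (1 - 1 / p) · log x → exp (-γ)`. -/
theorem tendsto_prod_one_sub_one_div_mul_log :
    Tendsto (fun x : ℝ => (∏ p ∈ Nat.primesLE ⌊x⌋₊, (1 - 1 / (p : ℝ))) * Real.log x) atTop
      (𝓝 (Real.exp (-Real.eulerMascheroniConstant))) := by
  have h := (tendsto_primeRecipSum_sub_log_log.add tendsto_sum_primesLE_logRemainder).neg
  rw [sub_add_cancel] at h
  refine ((Real.continuous_exp.tendsto _).comp h).congr' ?_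
  filter_upwards [eventually_gt_atTop 1] with x hx
  have hprod : ∏ p ∈ Nat.primesLE ⌊x⌋₊, (1 - 1 / (p : ℝ)) =
      Real.exp (-(primeRecipSum x + ∑ p ∈ Nat.primesLE ⌊x⌋₊, logRemainder (1 / (p : ℝ)))) := by
    rw [primeRecipSum, ← Finset.sum_add_distrib, ← Finset.sum_neg_distrib, Real.exp_sum]
    refine Finset.prod_congr rfl fun p hp => ?_
    have hlt := one_div_prime_le ⟨p, (Nat.mem_primesLE.1 hp).2⟩
    rw [logRemainder, add_sub_cancel, neg_neg, Real.exp_log (by linarith)]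
  rw [hprod, Function.comp_apply]
  conv_rhs => rw [← Real.exp_log (Real.log_pos hx), ← Real.exp_add]
  congr 1
  ring

/-! ### Comparison of the sieve probability with the density of the primes -/

theorem tendsto_sieveProduct_mul_log :
    Tendsto (fun n : ℕ => sieveProduct n * Real.log n) atTop
      (𝓝 (2 * Real.exp (-Real.eulerMascheroniConstant))) := by
  have h := (tendsto_prod_one_sub_one_div_mul_log.comp
    (Real.tendsto_sqrt_atTop.comp tendsto_natCast_atTop_atTop)).const_mul 2
  refine h.congr fun n => ?_
  rw [Function.comp_apply, Function.comp_apply, ← sieveProduct_eq_primesLE,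
    Real.log_sqrt n.cast_nonneg]
  ring

theorem log_natCast_ne_zero {n : ℕ} (hn : 2 ≤ n) : Real.log n ≠ 0 :=
  (Real.log_pos (by exact_mod_cast hn)).ne'

theorem eqOneAddLittleO_sieveProduct :
    EqOneAddLittleO sieveProduct
      (fun n => 2 * Real.exp (-Real.eulerMascheroniConstant) / Real.log n) := by
  have hc : 2 * Real.exp (-Real.eulerMascheroniConstant) ≠ 0 := by positivity
  refine eqOneAddLittleO_of_tendsto_div (fun n hn => div_ne_zero hc (log_natCast_ne_zero hn)) ?_
  have h := tendsto_sieveProduct_mul_log.div_const (2 * Real.exp (-Real.eulerMascheroniConstant))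
  rw [div_self hc] at h
  exact h.congr fun n => by rw [div_div_eq_mul_div]

theorem eqOneAddLittleO_primeCounting_div :
    EqOneAddLittleO (fun n => (Nat.primeCounting n : ℝ) / n) (fun n => 1 / Real.log n) := by
  refine eqOneAddLittleO_of_tendsto_div
    (fun n hn => one_div_ne_zero (log_natCast_ne_zero hn)) ?_
  exact tendsto_primeCounting_mul_log_div.congr fun n => by rw [div_div_eq_mul_div, div_one]

theorem tendsto_sieveProduct_div_primeCounting_div :
    Tendsto (fun n : ℕ => sieveProduct n / ((Nat.primeCounting n : ℝ) / n)) atTop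
      (𝓝 (2 * Real.exp (-Real.eulerMascheroniConstant))) := by
  have h := tendsto_sieveProduct_mul_log.div tendsto_primeCounting_mul_log_div one_ne_zero
  rw [div_one] at h
  refine h.congr' ?_
  filter_upwards [eventually_ge_atTop 2] with n hn
  exact mul_div_mul_right _ _ (log_natCast_ne_zero hn)

theorem mainTheorem4 :
    -- the multiples of a prime `p` have asymptotic density `1 / p`
    (∀ p : ℕ, p.Prime → HasAsymptoticDensity {m : ℕ | p ∣ m} (1 / (p : ℝ))) ∧
    -- independent events with these probabilities exist, and whenever they are given,
    -- the sieve probability is the product over `p ≤ √n`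
    (∃ (Ω : Type) (_ : MeasurableSpace Ω) (μ : Measure Ω) (D : Nat.Primes → Set Ω),
      IsSieveModel μ D) ∧
    (∀ (Ω : Type*) [MeasurableSpace Ω] (μ : Measure Ω) (D : Nat.Primes → Set Ω),
      IsSieveModel μ D → ∀ n : ℕ, μ.real (siftedEvent D n) = sieveProduct n) ∧
    -- asymptotics of the sieve probability
    EqOneAddLittleO sieveProduct
      (fun n => 2 * Real.exp (-Real.eulerMascheroniConstant) / Real.log n) ∧
    -- the true density of primes and its asymptotics
    (∀ n : ℕ, segmentDensity {m : ℕ | m.Prime} n = (Nat.primeCounting n : ℝ) / n) ∧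
    EqOneAddLittleO (fun n => (Nat.primeCounting n : ℝ) / n) (fun n => 1 / Real.log n) ∧
    -- the two differ asymptotically by the constant factor `2 e^{-γ}`, which is not `1`
    Tendsto (fun n : ℕ => sieveProduct n / ((Nat.primeCounting n : ℝ) / n)) atTop
      (𝓝 (2 * Real.exp (-Real.eulerMascheroniConstant))) ∧
    2 * Real.exp (-Real.eulerMascheroniConstant) ≠ 1 := by
  exact ⟨fun p _ => hasAsymptoticDensity_dvd p, exists_isSieveModel,
    fun _ _ _ _ h n => h.measureReal_siftedEvent n, eqOneAddLittleO_sieveProduct,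
    segmentDensity_prime, eqOneAddLittleO_primeCounting_div,
    tendsto_sieveProduct_div_primeCounting_div, two_mul_exp_neg_eulerMascheroniConstant_ne_one⟩
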